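/- **Conventions.** A Calabi–Yau threefold is a triple $(\overline M,\Omega,\omega)$ where $\overline M$ is a connected complex $3$-manifold, $\Omega$ is a nowhere vanishing holomorphic $3$-form and $\omega$ is a Kähler form with $\omega^3=c\,\Omega\wedge\overline\Omega$ for some constant $c$. An embedded $3$-torus $M\subset\overline M$ is special Lagrangian if $\omega|_M=0$, $\operatorname{Im}\Omega|_M=0$ and $\operatorname{Re}\Omega|_M=\mathrm{Vol}_M$. Let $\mathcal M$ be the local moduli space of special Lagrangian deformations $M_q$ of such a torus $M_0$. It is identified with a convex open neighbourhood $B$ of $0$ in $H^1(M_0,\mathbb R)=\mathbb R^3$ by affine coordinates $u$ such that, for a basis $\Sigma_1,\Sigma_2,\Sigma_3$ of $H_1(M_0,\mathbb Z)$, the variation field $V_k=\partial/\partial u_k$ satisfies $\int_{\Sigma_j}\omega(V_k,\cdot)=\delta_{kj}$. Let $\theta_1(q),\theta_2(q),\theta_3(q)$ be the harmonic $1$-forms on $M_q$ with $\int_{\Sigma_i}\theta_j=\delta_{ij}$, let $h_{ij}(q)=\langle\theta_i(q),\theta_j(q)\rangle_{L^2(M_q)}$, and put $\Phi(q)=\det(h_{ij}(q))$.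 Hitchin's semi-flat structure on $\mathcal X=\mathcal M\times H^1(M_0,\mathbb R/\mathbb Z)$ has complex coordinates $w_j=u_j+ix_j$, Kähler form $\check\omega=\sum_{i,j}h_{ij}(u)\,du_i\wedge dx_j$, holomorphic volume form $\check\Omega=dw_1\wedge dw_2\wedge dw_3$ and metric $\sum_{i,j}h_{ij}(u)(du_i\,du_j+dx_i\,dx_j)$. **Corollary.** There are one-parameter families of special Lagrangian $3$-tori along which $\Phi$ is not constant, and for which Hitchin's semi-flat metric is not Ricci-flat. More precisely: there are a Calabi–Yau structure $(\Omega,\omega)$ on the quotient by $\mathbb Z^3$ of a $\mathbb Z^3$-invariant open subset of $\mathbb C^3$ (where $\mathbb Z^3$ acts by translations of the real part), a number $\delta>0$, and functions $g_{11},g_{22},g_{33}$ of $(x_1,t)\in\mathbb R\times(-\delta,\delta)$, real-analytic and with $g_{11}g_{22}g_{33}=1$, such that: 1. for each $t\in(-\delta,\delta)$ the torus $M_t=\{y_1=t,\ y_2=y_3=0\}$ lies in the quotient and is special Lagrangian, with induced metric $\sum_i g_{ii}(x_1,t)\,dx_i^2$; 2. the tori $M_t$ form a smooth curve in the local moduli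 space $\mathcal M$ of $M_0$, and $\Phi$ is not constant along this curve; 3. for this $\mathcal M$, $\check\omega$ is a Kähler form on $\mathcal X$ and $\check\Omega$ is a nowhere vanishing holomorphic $3$-form, but there is no constant $c$ with $\check\omega^3=c\,\check\Omega\wedge\overline{\check\Omega}$, and the semi-flat metric is not Ricci-flat. -/

import Mathlib

open scoped BigOperators

noncomputable section

namespace SLagTori

/-! ### Kähler forms, holomorphic volume forms and Calabi-Yau structures in complex dimension 3

All spaces are open sets of `ℂ³`, or quotients of such open sets by a lattice of translations; tensors
on the quotient are written as lattice-invariant tensors upstairs. -/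

/-- The model space `ℂ³`, with real coordinates `z_k = x_k + i y_k`. -/
abbrev C3 : Type := Fin 3 → ℂ

/-- Coordinates `x = (x₁, x₂, x₃)` on `ℝ³`. The 3-torus is `ℝ³ / ℤ³`, and functions, metrics and forms
on it are `ℤ³`-periodic ones on `ℝ³`. -/
abbrev R3 : Type := Fin 3 → ℝ

/-- The `i`-th standard basis vector of `ℝ³`. -/
def e (i : Fin 3) : R3 := Pi.single i 1

/-- A vector of integers as a vector of `ℝ³`. -/
def intVec (k : Fin 3 → ℤ) : R3 := fun i => (k i : ℝ)

/-- A vector of integers as a (real) vector of `ℂ³`. -/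
def intVecC (k : Fin 3 → ℤ) : C3 := fun i => (k i : ℂ)

/-- The symmetric tensor `g(v, w) = ω(v, J w)` of a 2-form, `J` being multiplication by `i`. With this
convention `ω(v, w) = g(J v, w)`. -/
def kahlerMetric (ω : C3 [⋀^Fin 2]→L[ℝ] ℝ) (v w : C3) : ℝ := ω ![v, Complex.I • w]

/-- The 6-form `ω ∧ ω ∧ ω`, evaluated at six vectors. -/
def wedgeCube (ω : C3 [⋀^Fin 2]→L[ℝ] ℝ) (v : Fin 6 → C3) : ℝ :=
  (1 / 8) * ∑ σ : Equiv.Perm (Fin 6), ((Equiv.Perm.sign σ : ℤ) : ℝ) *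
    (ω ![v (σ 0), v (σ 1)] * ω ![v (σ 2), v (σ 3)] * ω ![v (σ 4), v (σ 5)])

/-- The 6-form `Ω ∧ conj Ω`, evaluated at six vectors. -/
def wedgeConj (Ω : C3 [⋀^Fin 3]→L[ℂ] ℂ) (v : Fin 6 → C3) : ℂ :=
  (1 / 36) * ∑ σ : Equiv.Perm (Fin 6), ((Equiv.Perm.sign σ : ℤ) : ℂ) *
    (Ω ![v (σ 0), v (σ 1), v (σ 2)] * starRingEnd ℂ (Ω ![v (σ 3), v (σ 4), v (σ 5)]))

/-- `ω` is a smooth Kähler form on the open set `U` of `ℂ³`. -/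
structure IsKahlerForm (U : Set C3) (ω : C3 → C3 [⋀^Fin 2]→L[ℝ] ℝ) : Prop where
  isOpen : IsOpen U
  smooth : ContDiffOn ℝ (⊤ : ℕ∞) ω U
  closed : ∀ p ∈ U, extDeriv ω p = 0
  type_one_one : ∀ p ∈ U, ∀ v w : C3, ω p ![Complex.I • v, Complex.I • w] = ω p ![v, w]
  positive : ∀ p ∈ U, ∀ v : C3, v ≠ 0 → 0 < kahlerMetric (ω p) v v

/-- `Ω` is a nowhere vanishing holomorphic 3-form on the open set `U` of `ℂ³`. -/
structure IsHolomorphicVolumeForm (U : Set C3) (Ω : C3 → C3 [⋀^Fin 3]→L[ℂ] ℂ) : Prop where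
  isOpen : IsOpen U
  holomorphic : DifferentiableOn ℂ Ω U
  nonvanishing : ∀ p ∈ U, Ω p ≠ 0

/-- The relation `ω³ = c Ω ∧ conj Ω` on `U`, for some constant `c`, which makes a Kähler form and a
holomorphic volume form a Calabi-Yau structure. -/
def CalabiYauRelation (U : Set C3) (Ω : C3 → C3 [⋀^Fin 3]→L[ℂ] ℂ)
    (ω : C3 → C3 [⋀^Fin 2]→L[ℝ] ℝ) : Prop :=
  ∃ c : ℂ, ∀ p ∈ U, ∀ v : Fin 6 → C3, (wedgeCube (ω p) v : ℂ) = c * wedgeConj (Ω p) v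

/-- `(U / ℤ³, Ω, ω)` is a (connected) Calabi-Yau threefold, where `U` is an open subset of `ℂ³` which is
invariant under `ℤ³` acting by translations of the real part; when `U` contains `ℝ³` it is a
neighbourhood of the standard torus in its standard complexification `ℂ³ / ℤ³`. -/
structure IsCalabiYau (U : Set C3) (Ω : C3 → C3 [⋀^Fin 3]→L[ℂ] ℂ)
    (ω : C3 → C3 [⋀^Fin 2]→L[ℝ] ℝ) : Prop where
  connected : IsConnected U
  invariant : ∀ p ∈ U, ∀ k : Fin 3 → ℤ, p + intVecC k ∈ U
  kahler : IsKahlerForm U ω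
  volume : IsHolomorphicVolumeForm U Ω
  kahler_periodic : ∀ p ∈ U, ∀ k : Fin 3 → ℤ, ω (p + intVecC k) = ω p
  volume_periodic : ∀ p ∈ U, ∀ k : Fin 3 → ℤ, Ω (p + intVecC k) = Ω p
  relation : CalabiYauRelation U Ω ω

/-! ### Ricci curvature -/

section Ricci

variable {ι : Type} [Fintype ι] [DecidableEq ι]

/-- Partial derivative in the `i`-th coordinate. -/
def pd (i : ι) (f : (ι → ℝ) → ℝ) (y : ι → ℝ) : ℝ := fderiv ℝ f y (Pi.single i 1)

/-- The Christoffel symbol `Γ^k_{ij}` of a metric given by its matrix in coordinates. -/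
def christoffel (g : (ι → ℝ) → Matrix ι ι ℝ) (k i j : ι) (y : ι → ℝ) : ℝ :=
  (1 / 2) * ∑ l, (g y)⁻¹ k l *
    (pd i (fun z => g z j l) y + pd j (fun z => g z i l) y - pd l (fun z => g z i j) y)

/-- The component `R_{ij}` of the Ricci tensor. -/
def ricci (g : (ι → ℝ) → Matrix ι ι ℝ) (i j : ι) (y : ι → ℝ) : ℝ :=
  ∑ k, (pd k (christoffel g k i j) y - pd j (christoffel g k i k) y +
    ∑ l, (christoffel g k k l y * christoffel g l i j y
      - christoffel g k j l y * christoffel g l i k y))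

end Ricci

/-- The point of `ℂ³` with given real and imaginary parts of its coordinates. -/
def toC3 (y : Fin 3 ⊕ Fin 3 → ℝ) : C3 :=
  fun j => (y (Sum.inl j) : ℂ) + (y (Sum.inr j) : ℂ) * Complex.I

/-- The coordinate vector fields of the real coordinates on `ℂ³`. -/
def coordVec : Fin 3 ⊕ Fin 3 → C3
  | Sum.inl j => Pi.single j 1
  | Sum.inr j => Pi.single j Complex.I

/-- The matrix, in the real coordinates of `ℂ³`, of the metric of a Kähler form. -/
def metricMatrix (ω : C3 → C3 [⋀^Fin 2]→L[ℝ] ℝ) (y : Fin 3 ⊕ Fin 3 → ℝ) :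
    Matrix (Fin 3 ⊕ Fin 3) (Fin 3 ⊕ Fin 3) ℝ :=
  Matrix.of fun a b => kahlerMetric (ω (toC3 y)) (coordVec a) (coordVec b)

/-- The metric of the Kähler form `ω` on `U` has vanishing Ricci tensor. -/
def IsRicciFlat (U : Set C3) (ω : C3 → C3 [⋀^Fin 2]→L[ℝ] ℝ) : Prop :=
  ∀ y, toC3 y ∈ U → ∀ a b, ricci (metricMatrix ω) a b y = 0

/-! ### Harmonic 1-forms on Riemannian 3-tori -/

/-- The 1-form `θ = ∑ θ_i dx_i` on the torus `ℝ³ / ℤ³` is smooth and is closed and coclosed for the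
metric `g`, i.e. `dθ = 0` and `d ⋆ θ = 0`. -/
structure IsHarmonicForm (g : R3 → Matrix (Fin 3) (Fin 3) ℝ) (θ : R3 → R3) : Prop where
  smooth : ContDiff ℝ (⊤ : ℕ∞) θ
  periodic : ∀ x, ∀ k : Fin 3 → ℤ, θ (x + intVec k) = θ x
  closed : ∀ x, ∀ i j : Fin 3, pd i (fun y => θ y j) x = pd j (fun y => θ y i) x
  coclosed : ∀ x, ∑ i, pd i (fun y => √(g y).det * ∑ j, (g y)⁻¹ i j * θ y j) x = 0

/-- The integral of a 1-form on `ℝ³ / ℤ³` over the `i`-th standard generator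
`Σ_i = {s e_i : 0 ≤ s ≤ 1}` of `H_1(ℝ³ / ℤ³, ℤ)`. -/
def period (i : Fin 3) (θ : R3 → R3) : ℝ := ∫ s in (0 : ℝ)..1, θ (s • e i) i

/-- `θ_1, θ_2, θ_3` are the harmonic 1-forms of `(ℝ³ / ℤ³, g)` dual to the basis `Σ_1, Σ_2, Σ_3` of
`H_1(ℝ³ / ℤ³, ℤ)`: `∫_{Σ_i} θ_j = δ_{ij}`. -/
structure IsDualHarmonicBasis (g : R3 → Matrix (Fin 3) (Fin 3) ℝ) (θ : Fin 3 → R3 → R3) : Prop where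
  harmonic : ∀ j, IsHarmonicForm g (θ j)
  dual : ∀ i j, period i (θ j) = if i = j then 1 else 0

/-- The `L²` inner product of two 1-forms on the Riemannian torus `(ℝ³ / ℤ³, g)`. -/
def l2Inner (g : R3 → Matrix (Fin 3) (Fin 3) ℝ) (α β : R3 → R3) : ℝ :=
  ∫ x in Set.Icc (0 : R3) 1, (∑ i, ∑ j, (g x)⁻¹ i j * α x i * β x j) * √(g x).det

/-- The matrix `⟨θ_i, θ_j⟩_{L²}`. -/
def l2Gram (g : R3 → Matrix (Fin 3) (Fin 3) ℝ) (θ : Fin 3 → R3 → R3) : Matrix (Fin 3) (Fin 3) ℝ :=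
  Matrix.of fun i j => l2Inner g (θ i) (θ j)

/-! ### Special Lagrangian tori and their moduli -/

/-- The tangent vector `∂F/∂x_i` of a map `F : ℝ³ → ℂ³`. -/
def tangent (F : R3 → C3) (i : Fin 3) (x : R3) : C3 := fderiv ℝ F x (e i)

/-- The metric induced on the torus by a map `F`, in the coordinates `x`. -/
def inducedMetric (ω : C3 → C3 [⋀^Fin 2]→L[ℝ] ℝ) (F : R3 → C3) (x : R3) : Matrix (Fin 3) (Fin 3) ℝ :=
  Matrix.of fun i j => kahlerMetric (ω (F x)) (tangent F i x) (tangent F j x)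

/-- `F` descends to a smooth embedding of the torus `ℝ³ / ℤ³` in `U / ℤ³`, inducing the identity of `ℤ³`
on first homology, whose image `M` is special Lagrangian: `ω|_M = 0`, `Im Ω|_M = 0` and
`Re Ω|_M = Vol_M`. -/
structure IsSLagTorus (U : Set C3) (Ω : C3 → C3 [⋀^Fin 3]→L[ℂ] ℂ)
    (ω : C3 → C3 [⋀^Fin 2]→L[ℝ] ℝ) (F : R3 → C3) : Prop where
  smooth : ContDiff ℝ (⊤ : ℕ∞) F
  mem : ∀ x, F x ∈ U
  equivariant : ∀ x, ∀ k : Fin 3 → ℤ, F (x + intVec k) = F x + intVecC k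
  immersion : ∀ x, Function.Injective (fderiv ℝ F x)
  injective : ∀ x x', ∀ k : Fin 3 → ℤ, F x' = F x + intVecC k → x' = x + intVec k
  lagrangian : ∀ x, ∀ i j : Fin 3, ω (F x) ![tangent F i x, tangent F j x] = 0
  im_eq_zero : ∀ x, (Ω (F x) ![tangent F 0 x, tangent F 1 x, tangent F 2 x]).im = 0
  re_eq_vol : ∀ x, (Ω (F x) ![tangent F 0 x, tangent F 1 x, tangent F 2 x]).re =
    √(inducedMetric ω F x).det

/-- `𝓕 : B → {special Lagrangian tori}` is a parametrization of the local moduli space `𝓜` of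
deformations of the special Lagrangian torus `F₀` by a convex open neighbourhood `B` of `0` in
`H¹(M₀, ℝ) = ℝ³`: distinct parameters give distinct submanifolds, every special Lagrangian torus which
is `C¹`-close to `F₀` occurs, and the parameter is the canonical affine coordinate, i.e. the variational
field `V_k = ∂𝓕/∂q_k` corresponds to the 1-form `(J V_k)^♭ = ω(V_k, ·)` on the torus with periods
`∫_{Σ_j} ω(V_k, ·) = δ_{kj}`. -/
structure IsLocalModuli (U : Set C3) (Ω : C3 → C3 [⋀^Fin 3]→L[ℂ] ℂ)
    (ω : C3 → C3 [⋀^Fin 2]→L[ℝ] ℝ) (F₀ : R3 → C3) (B : Set R3) (𝓕 : R3 → R3 → C3) : Prop where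
  isOpen : IsOpen B
  convex : Convex ℝ B
  zero_mem : (0 : R3) ∈ B
  base : 𝓕 0 = F₀
  smooth : ContDiffOn ℝ (⊤ : ℕ∞) (fun p : R3 × R3 => 𝓕 p.1 p.2) (B ×ˢ Set.univ)
  slag : ∀ q ∈ B, IsSLagTorus U Ω ω (𝓕 q)
  affine : ∀ q ∈ B, ∀ k j : Fin 3,
    period j (fun x i => ω (𝓕 q x) ![fderiv ℝ (fun q' => 𝓕 q' x) q (e k), tangent (𝓕 q) i x]) =
      if k = j then 1 else 0
  injective : ∀ q ∈ B, ∀ q' ∈ B, Set.range (𝓕 q) = Set.range (𝓕 q') → q = q'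
  complete : ∃ ε > 0, ∀ G : R3 → C3, IsSLagTorus U Ω ω G →
    (∀ x, ‖G x - F₀ x‖ < ε ∧ ‖fderiv ℝ G x - fderiv ℝ F₀ x‖ < ε) →
      ∃ q ∈ B, Set.range G = Set.range (𝓕 q)

/-- The horizontal slice `{y₁ = t, y₂ = y₃ = 0}` of the standard complexification. -/
def slice (t : ℝ) : R3 → C3 :=
  fun x => ![(x 0 : ℂ) + (t : ℂ) * Complex.I, (x 1 : ℂ), (x 2 : ℂ)]

/-! ### Hitchin's semi-flat structure on the mirror

The D-brane moduli space is `𝓧 = 𝓜 × H¹(M₀, ℝ/ℤ)`. With the affine coordinates `u ∈ B` of `𝓜` and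
the coordinates `x ∈ ℝ³ / ℤ³` on `H¹(M₀, ℝ/ℤ)`, Hitchin's complex coordinates are `w_j = u_j + i x_j`, so
that `𝓧` is the quotient of the tube `B + i ℝ³` by `i ℤ³`. -/

/-- The 2-form `α ∧ β`. -/
def wedgeTwo (α β : C3 →L[ℝ] ℝ) : C3 [⋀^Fin 2]→L[ℝ] ℝ :=
  { toFun := fun v => α (v 0) * β (v 1) - α (v 1) * β (v 0)
    map_update_add' := by
      intro _ v i x y
      fin_cases i <;> simp <;> ring
    map_update_smul' := by
      intro _ v i c x
      fin_cases i <;> simp <;> ring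
    cont := by fun_prop
    map_eq_zero_of_eq' := by
      intro v i j hv hij
      fin_cases i <;> fin_cases j <;> simp_all }

/-- `du_j`, the real part of the `j`-th coordinate. -/
def dRe (j : Fin 3) : C3 →L[ℝ] ℝ := Complex.reCLM.comp (ContinuousLinearMap.proj j)

/-- `dx_j`, the imaginary part of the `j`-th coordinate. -/
def dIm (j : Fin 3) : C3 →L[ℝ] ℝ := Complex.imCLM.comp (ContinuousLinearMap.proj j)

/-- The tube `B + i ℝ³`. -/
def tube (B : Set R3) : Set C3 := {w | (fun j => (w j).re) ∈ B}

/-- Hitchin's Kähler form `∑ h_{ij}(u) du_i ∧ dx_j` on the mirror, where `h` is the natural (`L²`) metric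
of the moduli space. Its metric is `∑ h_{ij}(u) (du_i du_j + dx_i dx_j)`. -/
def semiFlatForm (h : R3 → Matrix (Fin 3) (Fin 3) ℝ) (w : C3) : C3 [⋀^Fin 2]→L[ℝ] ℝ :=
  ∑ i, ∑ j, h (fun k => (w k).re) i j • wedgeTwo (dRe i) (dIm j)

/-- The holomorphic 3-form `dw_1 ∧ dw_2 ∧ dw_3`. -/
def stdVolumeForm : C3 [⋀^Fin 3]→L[ℂ] ℂ :=
  { (Matrix.detRowAlternating : C3 [⋀^Fin 3]→ₗ[ℂ] ℂ) with
    cont := by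
      change Continuous fun v : Fin 3 → C3 => Matrix.det (Matrix.of v)
      exact Continuous.matrix_det continuous_id }

end SLagTori

end

open SLagTori

noncomputable section

namespace SLagTori

/-! Take entire 1-periodic functions f₀ = 1, f₁, f₂ with positive real part on the strip |Im z₀| <
r, and define real coordinates (a, m) there by z_k = a_k + i m_k f_k(z₀). Differentiation gives the
(1,0)-forms η_k = dz_k - i m_k f_k'(z₀) dz₀ = da_k + i f_k dm_k, so Re η_k ∧ Im η_k = Re f_k da_k ∧
dm_k. Put ω = Σ w_k Re η_k ∧ Im η_k with w₁ = 1 / Re f₁, w₂ = 1 / Re f₂ and w₀ = Re f₁ Re f₂. The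
terms k = 1, 2 are da_k ∧ dm_k, the term k = 0 is a function of z₀ times dx₀ ∧ dy₀, so ω is closed.
The coframe η is a unipotent change of dz and w₀w₁w₂ = 1, so ω³ is a constant multiple of Ω ∧ conj Ω
for Ω = dz₀ ∧ dz₁ ∧ dz₂ (`IsPotentialTriple.isCalabiYau`).

On a level set of m the forms η_k restrict to da_k. It is therefore special Lagrangian with metric
diag(w₀, w₁, w₂) in the angles a (`IsPotentialTriple.isSLagTorus_torus`), and m = (t, 0, 0) is the
horizontal slice.

These level sets are all the special Lagrangian tori near the slice
(`IsPotentialTriple.exists_range_eq_range_torus`). The real translations in z₁, z₂ preserve the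
structure with moment maps m₁, m₂, and such a moment map restricts to a harmonic function on a
special Lagrangian, hence to a constant on a torus. Here this is an integration by parts
(`IsPotentialTriple.action_comp_slag`): the cofactors of the Jacobian are divergence free, and
pairing their imaginary parts with the moment map gives a vector field whose divergence is
nonnegative and integrates to zero. Both translations are then tangent to the torus, and reality of
Ω forces Im z₀ to be constant.

The harmonic forms are explicit: w₀ da₀ / ∫w₀, da₁, da₂. Their Gram matrix is diag(1 / ∫w₀, ∫Re f₁,
∫Re f₂). The chosen potentials have ∫Re f_k = 1 and ∫w₀ = e^{-4πt} (`isNormalizedTriple_potential`),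
so Φ = e^{4πt} along the slices. In the affine coordinate, ∫w₀ = 1 + 4πu₀, and the semi-flat metric
is a flat factor plus the metric (du₀² + dx₀²) / (1 + 4πu₀) on a plane. Its volume density is not
constant, and its Ricci tensor is nonzero at the origin (`ricci_semiFlatForm`). -/

@[simp] lemma wedgeTwo_apply (α β : C3 →L[ℝ] ℝ) (v : Fin 2 → C3) :
    wedgeTwo α β v = α (v 0) * β (v 1) - α (v 1) * β (v 0) := rfl

@[simp] lemma dRe_apply (j : Fin 3) (v : C3) : dRe j v = (v j).re := rfl

@[simp] lemma dIm_apply (j : Fin 3) (v : C3) : dIm j v = (v j).im := rfl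

/-- The exterior product of two covectors, as a continuous bilinear map. -/
def wedgeTwoL : (C3 →L[ℝ] ℝ) →L[ℝ] (C3 →L[ℝ] ℝ) →L[ℝ] C3 [⋀^Fin 2]→L[ℝ] ℝ :=
  (LinearMap.mk₂ ℝ wedgeTwo
    (by intros; ext; simp; ring) (by intros; ext; simp; ring)
    (by intros; ext; simp; ring) (by intros; ext; simp; ring)).toContinuousBilinearMap

@[simp] lemma wedgeTwoL_apply (α β : C3 →L[ℝ] ℝ) : wedgeTwoL α β = wedgeTwo α β := rfl

/-! ### Top-degree forms -/

/-- The matrix of values of six covectors at six vectors, the covectors being two triples in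
alternating order. -/
def covectorMatrix (A B : Fin 3 → C3 →L[ℝ] ℝ) (v : Fin 6 → C3) : Matrix (Fin 6) (Fin 6) ℝ :=
  Matrix.of ![fun j => A 0 (v j), fun j => B 0 (v j), fun j => A 1 (v j), fun j => B 1 (v j),
    fun j => A 2 (v j), fun j => B 2 (v j)]

/-- Antisymmetrization of a product of six covectors is a determinant. -/
lemma sum_sign_mul_prod {R : Type*} [CommRing R] (a : Fin 6 → Fin 6 → R) :
    ∑ σ : Equiv.Perm (Fin 6), ((Equiv.Perm.sign σ : ℤ) : R) *
      (a 0 (σ 0) * a 1 (σ 1) * a 2 (σ 2) * a 3 (σ 3) * a 4 (σ 4) * a 5 (σ 5)) =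
    (Matrix.of a).det := by
  rw [← Matrix.det_transpose, Matrix.det_apply']
  simp [Fin.prod_univ_six]

/-- A permutation of the arguments changes an antisymmetrization by its sign. -/
lemma sum_sign_mul_comp {R : Type*} [CommRing R] (f : (Fin 6 → Fin 6) → R)
    (τ : Equiv.Perm (Fin 6)) :
    ∑ σ : Equiv.Perm (Fin 6), ((Equiv.Perm.sign σ : ℤ) : R) * f (fun k => σ (τ k)) =
    ((Equiv.Perm.sign τ : ℤ) : R) *
      ∑ σ : Equiv.Perm (Fin 6), ((Equiv.Perm.sign σ : ℤ) : R) * f σ := by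
  rw [Finset.mul_sum]
  refine Fintype.sum_equiv (Equiv.mulRight τ) _ _ fun σ => ?_
  have h : ((Equiv.Perm.sign τ : ℤ) : R) * ((Equiv.Perm.sign τ : ℤ) : R) = 1 := by
    rw [← Int.cast_mul, ← Units.val_mul, Int.units_mul_self]
    simp
  simp only [Equiv.coe_mulRight, Equiv.Perm.sign_mul, Equiv.Perm.coe_mul, Function.comp_def,
    Units.val_mul, Int.cast_mul]
  linear_combination (-((Equiv.Perm.sign σ : ℤ) : R) * f (fun k => σ (τ k))) * h

/-- Exchanging the two arguments of one factor is an odd permutation, so each of the three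
antisymmetrized factors may be replaced by its first term at the cost of a factor 2. -/
lemma sum_sign_wedge (a b c d e f : Fin 6 → ℝ) :
    ∑ σ : Equiv.Perm (Fin 6), ((Equiv.Perm.sign σ : ℤ) : ℝ) *
      ((a (σ 0) * b (σ 1) - a (σ 1) * b (σ 0)) * (c (σ 2) * d (σ 3) - c (σ 3) * d (σ 2)) *
        (e (σ 4) * f (σ 5) - e (σ 5) * f (σ 4))) =
    8 * (Matrix.of ![a, b, c, d, e, f]).det := by
  have key : ∀ g : (Fin 6 → Fin 6) → ℝ, ∀ i j, i ≠ j →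
      ∑ σ : Equiv.Perm (Fin 6), ((Equiv.Perm.sign σ : ℤ) : ℝ) *
        (g σ - g (fun k => σ (Equiv.swap i j k))) =
      2 * ∑ σ : Equiv.Perm (Fin 6), ((Equiv.Perm.sign σ : ℤ) : ℝ) * g σ := by
    intro g i j hij
    simp only [mul_sub, Finset.sum_sub_distrib]
    rw [sum_sign_mul_comp g (Equiv.swap i j), Equiv.Perm.sign_swap hij]
    push_cast
    ring
  have h0 := sum_sign_mul_prod ![a, b, c, d, e, f]
  have h1 := key (fun s => a (s 0) * b (s 1) * c (s 2) * d (s 3) * e (s 4) * f (s 5)) 4 5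
    (by decide)
  have h2 := key (fun s => a (s 0) * b (s 1) * c (s 2) * d (s 3) *
    (e (s 4) * f (s 5) - e (s 5) * f (s 4))) 2 3 (by decide)
  have h3 := key (fun s => a (s 0) * b (s 1) * (c (s 2) * d (s 3) - c (s 3) * d (s 2)) *
    (e (s 4) * f (s 5) - e (s 5) * f (s 4))) 0 1 (by decide)
  have e1 : ∀ i j : Fin 6, Equiv.swap i j i = j := Equiv.swap_apply_left
  have e2 : ∀ i j : Fin 6, Equiv.swap i j j = i := Equiv.swap_apply_right
  have e3 : ∀ i j k : Fin 6, k ≠ i → k ≠ j → Equiv.swap i j k = k :=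
    fun i j k => Equiv.swap_apply_of_ne_of_ne
  rw [← h0]
  simp only [e1, e2, e3 4 5 0 (by decide) (by decide), e3 4 5 1 (by decide) (by decide),
    e3 4 5 2 (by decide) (by decide), e3 4 5 3 (by decide) (by decide),
    e3 2 3 0 (by decide) (by decide), e3 2 3 1 (by decide) (by decide),
    e3 2 3 4 (by decide) (by decide), e3 2 3 5 (by decide) (by decide),
    e3 0 1 2 (by decide) (by decide), e3 0 1 3 (by decide) (by decide),
    e3 0 1 4 (by decide) (by decide), e3 0 1 5 (by decide) (by decide)] at h1 h2 h3
  simp only [Matrix.cons_val]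
  have t : (8 : ℝ) * ∑ σ : Equiv.Perm (Fin 6), ((Equiv.Perm.sign σ : ℤ) : ℝ) *
      (a (σ 0) * b (σ 1) * c (σ 2) * d (σ 3) * e (σ 4) * f (σ 5)) =
      2 * (2 * (2 * ∑ σ : Equiv.Perm (Fin 6), ((Equiv.Perm.sign σ : ℤ) : ℝ) *
      (a (σ 0) * b (σ 1) * c (σ 2) * d (σ 3) * e (σ 4) * f (σ 5)))) := by ring
  rw [t, ← h1]
  have r1 : ∑ σ : Equiv.Perm (Fin 6), ((Equiv.Perm.sign σ : ℤ) : ℝ) *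
      (a (σ 0) * b (σ 1) * c (σ 2) * d (σ 3) * e (σ 4) * f (σ 5) -
        a (σ 0) * b (σ 1) * c (σ 2) * d (σ 3) * e (σ 5) * f (σ 4)) =
      ∑ σ : Equiv.Perm (Fin 6), ((Equiv.Perm.sign σ : ℤ) : ℝ) *
      (a (σ 0) * b (σ 1) * c (σ 2) * d (σ 3) * (e (σ 4) * f (σ 5) - e (σ 5) * f (σ 4))) :=
    Finset.sum_congr rfl fun σ _ => by ring
  rw [r1, ← h2]
  have r2 : ∑ σ : Equiv.Perm (Fin 6), ((Equiv.Perm.sign σ : ℤ) : ℝ) *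
      (a (σ 0) * b (σ 1) * c (σ 2) * d (σ 3) * (e (σ 4) * f (σ 5) - e (σ 5) * f (σ 4)) -
        a (σ 0) * b (σ 1) * c (σ 3) * d (σ 2) * (e (σ 4) * f (σ 5) - e (σ 5) * f (σ 4))) =
      ∑ σ : Equiv.Perm (Fin 6), ((Equiv.Perm.sign σ : ℤ) : ℝ) *
      (a (σ 0) * b (σ 1) * (c (σ 2) * d (σ 3) - c (σ 3) * d (σ 2)) *
        (e (σ 4) * f (σ 5) - e (σ 5) * f (σ 4))) :=
    Finset.sum_congr rfl fun σ _ => by ring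
  rw [r2, ← h3]
  exact Finset.sum_congr rfl fun σ _ => by ring

/-- The cube of a sum of three decomposable 2-forms. -/
lemma wedgeCube_sum (r : Fin 3 → ℝ) (A B : Fin 3 → C3 →L[ℝ] ℝ) (v : Fin 6 → C3) :
    wedgeCube (∑ k, r k • wedgeTwo (A k) (B k)) v =
      6 * (r 0 * r 1 * r 2) * (covectorMatrix A B v).det := by
  let row : Fin 3 → Fin 3 → Fin 3 → Matrix (Fin 6) (Fin 6) ℝ := fun k l m =>
    Matrix.of ![fun j => A k (v j), fun j => B k (v j), fun j => A l (v j), fun j => B l (v j),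
      fun j => A m (v j), fun j => B m (v j)]
  have hexp : wedgeCube (∑ k, r k • wedgeTwo (A k) (B k)) v =
      ∑ k, ∑ l, ∑ m, r k * r l * r m * (row k l m).det := by
    have hrow : ∀ k l m, (row k l m).det = (1 / 8) *
        ∑ σ : Equiv.Perm (Fin 6), ((Equiv.Perm.sign σ : ℤ) : ℝ) *
          (wedgeTwo (A k) (B k) ![v (σ 0), v (σ 1)] * wedgeTwo (A l) (B l) ![v (σ 2), v (σ 3)] *
            wedgeTwo (A m) (B m) ![v (σ 4), v (σ 5)]) := by
      intro k l m
      have := sum_sign_wedge (fun j => A k (v j)) (fun j => B k (v j)) (fun j => A l (v j))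
        (fun j => B l (v j)) (fun j => A m (v j)) (fun j => B m (v j))
      simp only [wedgeTwo_apply, Matrix.cons_val_zero, Matrix.cons_val_one]
      rw [this]
      simp only [row]
      ring
    have hcomm : ∀ F : Fin 3 → Fin 3 → Fin 3 → Equiv.Perm (Fin 6) → ℝ,
        ∑ k, ∑ l, ∑ m, ∑ σ, F k l m σ = ∑ σ, ∑ k, ∑ l, ∑ m, F k l m σ := by
      intro F
      simp only [Fin.sum_univ_three, Finset.sum_add_distrib]
    simp only [hrow, wedgeCube, Finset.mul_sum]
    rw [hcomm]
    refine Finset.sum_congr rfl fun σ _ => ?_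
    simp only [Fin.sum_univ_three, ContinuousAlternatingMap.add_apply,
      ContinuousAlternatingMap.smul_apply, smul_eq_mul]
    ring
  -- Of the 27 terms only the six with distinct indices survive; they are equal because exchanging
  -- two pairs of rows is an even permutation. This is the factor 6.
  have h1 : ∀ k m, (row k k m).det = 0 := fun k m =>
    Matrix.det_zero_of_row_eq (i := 0) (j := 2) (by decide) rfl
  have h2 : ∀ k m, (row k m k).det = 0 := fun k m =>
    Matrix.det_zero_of_row_eq (i := 0) (j := 4) (by decide) rfl
  have h3 : ∀ k m, (row m k k).det = 0 := fun k m =>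
    Matrix.det_zero_of_row_eq (i := 2) (j := 4) (by decide) rfl
  have h4 : ∀ k l m, (row l k m).det = (row k l m).det := by
    intro k l m
    have := Matrix.det_permute (Equiv.swap (0 : Fin 6) 2 * Equiv.swap 1 3) (row k l m)
    rw [show Equiv.Perm.sign (Equiv.swap (0 : Fin 6) 2 * Equiv.swap 1 3) = 1 by decide] at this
    simp only [Units.val_one, Int.cast_one, one_mul] at this
    rw [← this]
    congr 1
    ext i j
    fin_cases i <;> rfl
  have h5 : ∀ k l m, (row k m l).det = (row k l m).det := by
    intro k l m
    have := Matrix.det_permute (Equiv.swap (2 : Fin 6) 4 * Equiv.swap 3 5) (row k l m)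
    rw [show Equiv.Perm.sign (Equiv.swap (2 : Fin 6) 4 * Equiv.swap 3 5) = 1 by decide] at this
    simp only [Units.val_one, Int.cast_one, one_mul] at this
    rw [← this]
    congr 1
    ext i j
    fin_cases i <;> rfl
  have h6 : (row 0 1 2).det = (covectorMatrix A B v).det := rfl
  rw [hexp]
  simp only [Fin.sum_univ_three, h1, h2, h3, h5 0 1 2, h4 0 1 2, h5 1 0 2, h4 0 2 1, h5 2 0 1,
    h6]
  ring

/-- The change of basis from `dx_k, dy_k` to `dz_k, d\bar z_k`. -/
def conjChange : Matrix (Fin 6) (Fin 6) ℂ :=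
  Matrix.of ![![1, Complex.I, 0, 0, 0, 0], ![0, 0, 1, Complex.I, 0, 0], ![0, 0, 0, 0, 1, Complex.I],
    ![1, -Complex.I, 0, 0, 0, 0], ![0, 0, 1, -Complex.I, 0, 0], ![0, 0, 0, 0, 1, -Complex.I]]

/-- The second factor is twice the inverse: x = (z + conj z) / 2 and y = (z - conj z) / 2i. -/
lemma det_conjChange_ne_zero : conjChange.det ≠ 0 := by
  have h : conjChange * Matrix.of ![![1, 0, 0, 1, 0, 0], ![-Complex.I, 0, 0, Complex.I, 0, 0],
      ![0, 1, 0, 0, 1, 0], ![0, -Complex.I, 0, 0, Complex.I, 0],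
      ![0, 0, 1, 0, 0, 1], ![0, 0, -Complex.I, 0, 0, Complex.I]] = (2 : ℂ) • 1 := by
    ext i j
    fin_cases i <;> fin_cases j <;>
      simp [conjChange, Matrix.mul_apply, Fin.sum_univ_six] <;> norm_num
  intro h0
  have := congrArg Matrix.det h
  rw [Matrix.det_mul, h0] at this
  norm_num at this

lemma stdVolumeForm_apply (v : Fin 3 → C3) : stdVolumeForm v = (Matrix.of v).det := rfl

/-- Antisymmetrization of a product of two 3-by-3 determinants. -/
lemma sum_sign_det (a b : Fin 3 → Fin 6 → ℂ) :
    ∑ σ : Equiv.Perm (Fin 6), ((Equiv.Perm.sign σ : ℤ) : ℂ) *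
      ((Matrix.of fun i k => a k (σ (Fin.castAdd 3 i))).det *
        (Matrix.of fun i k => b k (σ (Fin.natAdd 3 i))).det) =
    36 * (Matrix.of (Fin.append a b : Fin 6 → Fin 6 → ℂ)).det := by
  -- Expanding both determinants introduces a block permutation in S₃ × S₃ ⊂ S₆. Absorbing it in σ
  -- cancels its sign, so the sum consists of 36 copies of the large determinant.
  let ρ : Equiv.Perm (Fin 3) → Equiv.Perm (Fin 3) → Equiv.Perm (Fin 6) := fun τ τ' =>
    (finSumFinEquiv (m := 3) (n := 3)).permCongr (Equiv.Perm.sumCongr τ τ')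
  have hρ : ∀ τ τ', Equiv.Perm.sign (ρ τ τ') = Equiv.Perm.sign τ * Equiv.Perm.sign τ' := by
    intro τ τ'
    simp only [ρ, Equiv.Perm.sign_permCongr, Equiv.Perm.sign_sumCongr]
  have hρ1 : ∀ τ τ' i, ρ τ τ' (Fin.castAdd 3 i) = Fin.castAdd 3 (τ i) := by
    intro τ τ' i
    change finSumFinEquiv (Sum.map τ τ' (finSumFinEquiv.symm (Fin.castAdd 3 i))) = _
    rw [finSumFinEquiv_symm_apply_castAdd]
    rfl
  have hρ2 : ∀ τ τ' i, ρ τ τ' (Fin.natAdd 3 i) = Fin.natAdd 3 (τ' i) := by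
    intro τ τ' i
    change finSumFinEquiv (Sum.map τ τ' (finSumFinEquiv.symm (Fin.natAdd 3 i))) = _
    rw [finSumFinEquiv_symm_apply_natAdd]
    rfl
  let f : (Fin 6 → Fin 6) → ℂ := fun s => ∏ j : Fin (3 + 3), Fin.append a b j (s j)
  have hf : ∀ s, f s = (∏ i, a i (s (Fin.castAdd 3 i))) * ∏ i, b i (s (Fin.natAdd 3 i)) := by
    intro s
    simp only [f, Fin.prod_univ_add, Fin.append_left, Fin.append_right]
  have hterm : ∀ σ : Equiv.Perm (Fin 6),
      (Matrix.of fun i k => a k (σ (Fin.castAdd 3 i))).det *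
        (Matrix.of fun i k => b k (σ (Fin.natAdd 3 i))).det =
      ∑ τ, ∑ τ', ((Equiv.Perm.sign (ρ τ τ') : ℤ) : ℂ) * f (fun k => σ (ρ τ τ' k)) := by
    intro σ
    rw [Matrix.det_apply', Matrix.det_apply', Finset.sum_mul_sum]
    refine Finset.sum_congr rfl fun τ _ => Finset.sum_congr rfl fun τ' _ => ?_
    rw [hf, hρ]
    simp only [hρ1, hρ2, Matrix.of_apply]
    push_cast
    ring
  have hdet : (Matrix.of (Fin.append a b : Fin 6 → Fin 6 → ℂ)).det =
      ∑ σ : Equiv.Perm (Fin 6), ((Equiv.Perm.sign σ : ℤ) : ℂ) * f σ := by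
    rw [← Matrix.det_transpose, Matrix.det_apply']
    rfl
  have hone : ∀ u : ℤˣ, ((u : ℤ) : ℂ) * ((u : ℤ) : ℂ) = 1 := by
    intro u
    rw [← Int.cast_mul, ← Units.val_mul, Int.units_mul_self]
    simp
  calc _ = ∑ σ : Equiv.Perm (Fin 6), ∑ τ, ∑ τ', ((Equiv.Perm.sign (ρ τ τ') : ℤ) : ℂ) *
        (((Equiv.Perm.sign σ : ℤ) : ℂ) * f (fun k => σ (ρ τ τ' k))) := by
        refine Finset.sum_congr rfl fun σ _ => ?_
        rw [hterm, Finset.mul_sum]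
        refine Finset.sum_congr rfl fun τ _ => ?_
        rw [Finset.mul_sum]
        exact Finset.sum_congr rfl fun τ' _ => by ring
    _ = ∑ τ, ∑ τ', ((Equiv.Perm.sign (ρ τ τ') : ℤ) : ℂ) *
        ∑ σ : Equiv.Perm (Fin 6), (((Equiv.Perm.sign σ : ℤ) : ℂ) * f (fun k => σ (ρ τ τ' k))) := by
        rw [Finset.sum_comm]
        refine Finset.sum_congr rfl fun τ _ => ?_
        rw [Finset.sum_comm]
        exact Finset.sum_congr rfl fun τ' _ => by rw [Finset.mul_sum]
    _ = ∑ τ : Equiv.Perm (Fin 3), ∑ τ' : Equiv.Perm (Fin 3),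
        (Matrix.of (Fin.append a b : Fin 6 → Fin 6 → ℂ)).det := by
        refine Finset.sum_congr rfl fun τ _ => Finset.sum_congr rfl fun τ' _ => ?_
        rw [sum_sign_mul_comp f, ← mul_assoc, hone, one_mul, hdet]
    _ = _ := by
        simp only [Finset.sum_const, Finset.card_univ, Fintype.card_perm, Fintype.card_fin,
          nsmul_eq_mul]
        norm_num [Nat.factorial]
        ring

/-- `Ω ∧ conj Ω` for the standard form, in real coordinates. -/
lemma wedgeConj_stdVolumeForm (v : Fin 6 → C3) :
    wedgeConj stdVolumeForm v = conjChange.det * ((covectorMatrix dRe dIm v).det : ℂ) := by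
  let a : Fin 3 → Fin 6 → ℂ := fun k j => v j k
  let b : Fin 3 → Fin 6 → ℂ := fun k j => starRingEnd ℂ (v j k)
  have h := sum_sign_det a b
  have hmat : (Matrix.of (Fin.append a b : Fin 6 → Fin 6 → ℂ)) =
      conjChange * (covectorMatrix dRe dIm v).map (Complex.ofRealHom) := by
    ext i j
    have hz : ∀ z : ℂ, z = z.re + Complex.I * z.im := fun z => by
      rw [mul_comm]; exact (Complex.re_add_im z).symm
    have hc : ∀ z : ℂ, starRingEnd ℂ z = z.re - Complex.I * z.im := fun z => by
      apply Complex.ext <;> simp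
    fin_cases i <;>
      simp [Matrix.mul_apply, Fin.sum_univ_six, conjChange, covectorMatrix, a, b, Fin.append,
        Fin.addCases, hc, ← sub_eq_add_neg] <;> exact hz _
  have hdetmap : ((covectorMatrix dRe dIm v).map (Complex.ofRealHom)).det =
      ((covectorMatrix dRe dIm v).det : ℂ) := (RingHom.map_det Complex.ofRealHom _).symm
  rw [hmat, Matrix.det_mul, hdetmap] at h
  have : ∀ σ : Equiv.Perm (Fin 6),
      stdVolumeForm ![v (σ 0), v (σ 1), v (σ 2)] *
        starRingEnd ℂ (stdVolumeForm ![v (σ 3), v (σ 4), v (σ 5)]) =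
      (Matrix.of fun i k => a k (σ (Fin.castAdd 3 i))).det *
        (Matrix.of fun i k => b k (σ (Fin.natAdd 3 i))).det := by
    intro σ
    rw [stdVolumeForm_apply, stdVolumeForm_apply, RingHom.map_det]
    refine congrArg₂ (fun M N => Matrix.det M * Matrix.det N) ?_ ?_
    · ext i k
      fin_cases i <;> rfl
    · ext i k
      fin_cases i <;> rfl
  rw [wedgeConj, Finset.sum_congr rfl fun σ _ => by rw [this σ], h]
  ring

/-- The standard basis in alternating order has unit determinant. -/
lemma exists_covectorMatrix_eq_one : ∃ v : Fin 6 → C3, covectorMatrix dRe dIm v = 1 := by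
  refine ⟨![Pi.single 0 1, Pi.single 0 Complex.I, Pi.single 1 1, Pi.single 1 Complex.I,
    Pi.single 2 1, Pi.single 2 Complex.I], ?_⟩
  ext i j
  fin_cases i <;> fin_cases j <;> simp [covectorMatrix]

/-- A unipotent change of the coframe does not change the volume. -/
lemma det_covectorMatrix_shear (c : Fin 3 → ℂ) (hc : c 0 = 0) (A B : Fin 3 → C3 →L[ℝ] ℝ)
    (hA : ∀ k w, A k w = (w k - c k * w 0).re) (hB : ∀ k w, B k w = (w k - c k * w 0).im)
    (v : Fin 6 → C3) : (covectorMatrix A B v).det = (covectorMatrix dRe dIm v).det := by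
  -- The real form of w_k ↦ w_k - c_k w₀, which is lower unitriangular.
  let T : Matrix (Fin 6) (Fin 6) ℝ := Matrix.of ![![1, 0, 0, 0, 0, 0], ![0, 1, 0, 0, 0, 0],
    ![-(c 1).re, (c 1).im, 1, 0, 0, 0], ![-(c 1).im, -(c 1).re, 0, 1, 0, 0],
    ![-(c 2).re, (c 2).im, 0, 0, 1, 0], ![-(c 2).im, -(c 2).re, 0, 0, 0, 1]]
  have hT : T.det = 1 := by
    have hl : T.BlockTriangular OrderDual.toDual := by
      intro i j hij
      change i < j at hij
      fin_cases i <;> fin_cases j <;> first | rfl | (exfalso; revert hij; decide)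
    rw [Matrix.det_of_isLowerTriangular T hl]
    simp [Fin.prod_univ_six, T]
  have hmul : covectorMatrix A B v = T * covectorMatrix dRe dIm v := by
    ext i j
    fin_cases i <;>
      simp [Matrix.mul_apply, Fin.sum_univ_six, covectorMatrix, T, hA, hB, hc] <;> ring
  rw [hmul, Matrix.det_mul, hT, one_mul]

/-- The Calabi-Yau relation with the standard volume form holds for a sheared coframe with weights
of constant product. -/
lemma calabiYauRelation_of_shear (U : Set C3) (ω : C3 → C3 [⋀^Fin 2]→L[ℝ] ℝ)
    (r : C3 → Fin 3 → ℝ) (c : C3 → Fin 3 → ℂ) (A B : C3 → Fin 3 → C3 →L[ℝ] ℝ)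
    (hω : ∀ p ∈ U, ω p = ∑ k, r p k • wedgeTwo (A p k) (B p k))
    (hr : ∀ p ∈ U, r p 0 * r p 1 * r p 2 = 1) (hc : ∀ p, c p 0 = 0)
    (hA : ∀ p k w, A p k w = (w k - c p k * w 0).re)
    (hB : ∀ p k w, B p k w = (w k - c p k * w 0).im) :
    CalabiYauRelation U (fun _ => stdVolumeForm) ω := by
  refine ⟨6 / conjChange.det, fun p hp v => ?_⟩
  rw [hω p hp, wedgeCube_sum, hr p hp, wedgeConj_stdVolumeForm,
    det_covectorMatrix_shear (c p) (hc p) _ _ (hA p) (hB p)]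
  have := det_conjChange_ne_zero
  push_cast
  field_simp

/-- The Calabi-Yau relation with the standard volume form forces weights of constant product. -/
lemma CalabiYauRelation.weight_prod_eq {U : Set C3} {ω : C3 → C3 [⋀^Fin 2]→L[ℝ] ℝ}
    {r : C3 → Fin 3 → ℝ} (h : CalabiYauRelation U (fun _ => stdVolumeForm) ω)
    (hω : ∀ p ∈ U, ω p = ∑ k, r p k • wedgeTwo (dRe k) (dIm k)) {p q : C3} (hp : p ∈ U)
    (hq : q ∈ U) : r p 0 * r p 1 * r p 2 = r q 0 * r q 1 * r q 2 := by
  obtain ⟨c, hc⟩ := h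
  -- The right-hand side of the relation does not depend on the point, so comparing the two points
  -- on a single frame of unit determinant suffices.
  obtain ⟨v, hv⟩ := exists_covectorMatrix_eq_one
  have h1 := (hc p hp v).trans (hc q hq v).symm
  rw [hω p hp, hω q hq, wedgeCube_sum, wedgeCube_sum, hv] at h1
  have h2 := Complex.ofReal_injective h1
  simp only [Matrix.det_one, mul_one] at h2
  linarith

/-! ### A torus-invariant Calabi-Yau metric

Three entire functions `f 0 = 1`, `f 1`, `f 2` of period `1`, with positive real part on a strip,
define a Kähler metric of unit volume on that strip. It is invariant under real translations in
the second and third coordinates, and Darboux coordinates are explicit. -/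

/-- Entire functions of period `1` with positive real part on the strip `|Im z| < r`, the first one
being constant. -/
structure IsPotentialTriple (r : ℝ) (f : Fin 3 → ℂ → ℂ) : Prop where
  zero : ∀ z, f 0 z = 1
  differentiable : ∀ k, Differentiable ℂ (f k)
  periodic : ∀ k z, f k (z + 1) = f k z
  pos : ∀ k z, |z.im| < r → 0 < (f k z).re

/-! ### Action-angle coordinates and the adapted coframe. -/

/-- The strip `|Im z₀| < r` in `ℂ³`. -/
def strip (r : ℝ) : Set C3 := {p | |(p 0).im| < r}

/-- The action coordinates. -/
def action (f : Fin 3 → ℂ → ℂ) (k : Fin 3) (p : C3) : ℝ := (p k).im / (f k (p 0)).re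

/-- The angle coordinates. -/
def angle (f : Fin 3 → ℂ → ℂ) (k : Fin 3) (p : C3) : ℝ :=
  (p k).re + action f k p * (f k (p 0)).im

/-- The coefficient of `dz₀` in the `k`-th form of the unitary coframe. -/
def shear (f : Fin 3 → ℂ → ℂ) (p : C3) (k : Fin 3) : ℂ :=
  Complex.I * action f k p * deriv (f k) (p 0)

/-- The (unnormalized) unitary coframe. -/
def coframe (f : Fin 3 → ℂ → ℂ) (p : C3) (k : Fin 3) (v : C3) : ℂ := v k - shear f p k * v 0

/-- The real part of the coframe. -/
def coframeRe (f : Fin 3 → ℂ → ℂ) (p : C3) (k : Fin 3) : C3 →L[ℝ] ℝ :=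
  dRe k - (shear f p k).re • dRe 0 + (shear f p k).im • dIm 0

/-- The imaginary part of the coframe. -/
def coframeIm (f : Fin 3 → ℂ → ℂ) (p : C3) (k : Fin 3) : C3 →L[ℝ] ℝ :=
  dIm k - (shear f p k).re • dIm 0 - (shear f p k).im • dRe 0

/-- The squared norms of the dual frame. -/
def weight (f : Fin 3 → ℂ → ℂ) (z : ℂ) : Fin 3 → ℝ :=
  ![(f 1 z).re * (f 2 z).re, ((f 1 z).re)⁻¹, ((f 2 z).re)⁻¹]

/-- The Kähler form. -/
def ansatzForm (f : Fin 3 → ℂ → ℂ) (p : C3) : C3 [⋀^Fin 2]→L[ℝ] ℝ :=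
  ∑ k, weight f (p 0) k • wedgeTwo (coframeRe f p k) (coframeIm f p k)

@[simp] lemma coframeRe_apply (f : Fin 3 → ℂ → ℂ) (p : C3) (k : Fin 3) (v : C3) :
    coframeRe f p k v = (coframe f p k v).re := by
  simp [coframeRe, coframe]
  ring

@[simp] lemma coframeIm_apply (f : Fin 3 → ℂ → ℂ) (p : C3) (k : Fin 3) (v : C3) :
    coframeIm f p k v = (coframe f p k v).im := by
  simp [coframeIm, coframe]
  ring

lemma coframe_smul (f : Fin 3 → ℂ → ℂ) (p : C3) (k : Fin 3) (c : ℂ) (v : C3) :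
    coframe f p k (c • v) = c * coframe f p k v := by
  simp [coframe]
  ring

lemma coframe_sum (f : Fin 3 → ℂ → ℂ) (p : C3) (k : Fin 3) {ι : Type*} (s : Finset ι)
    (v : ι → C3) : coframe f p k (∑ j ∈ s, v j) = ∑ j ∈ s, coframe f p k (v j) := by
  simp [coframe, Finset.sum_apply, Finset.mul_sum, Finset.sum_sub_distrib]

lemma ansatzForm_apply (f : Fin 3 → ℂ → ℂ) (p v w : C3) :
    ansatzForm f p ![v, w] = ∑ k, weight f (p 0) k * ((coframe f p k v).re * (coframe f p k w).im -
      (coframe f p k w).re * (coframe f p k v).im) := by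
  simp [ansatzForm, Fin.sum_univ_three]

lemma kahlerMetric_ansatzForm (f : Fin 3 → ℂ → ℂ) (p v w : C3) :
    kahlerMetric (ansatzForm f p) v w =
      ∑ k, weight f (p 0) k * ((coframe f p k v).re * (coframe f p k w).re +
        (coframe f p k v).im * (coframe f p k w).im) := by
  rw [kahlerMetric, ansatzForm_apply]
  refine Finset.sum_congr rfl fun k _ => ?_
  rw [coframe_smul]
  simp
  ring_nf
  simp

/-! ### Closed two-forms -/

lemma removeNth_three {E : Type*} (v : Fin (2 + 1) → E) :
    Fin.removeNth 0 v 0 = v 1 ∧ Fin.removeNth 0 v 1 = v 2 ∧ Fin.removeNth 1 v 0 = v 0 ∧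
      Fin.removeNth 1 v 1 = v 2 ∧ Fin.removeNth 2 v 0 = v 0 ∧ Fin.removeNth 2 v 1 = v 1 :=
  ⟨rfl, rfl, rfl, rfl, rfl, rfl⟩

/-- Products of differentials are closed. -/
lemma extDeriv_wedgeTwo_fderiv {u w : C3 → ℝ} {p : C3} (hu : ContDiffAt ℝ 2 u p)
    (hw : ContDiffAt ℝ 2 w p) :
    DifferentiableAt ℝ (fun q => wedgeTwo (fderiv ℝ u q) (fderiv ℝ w q)) p ∧
    extDeriv (fun q => wedgeTwo (fderiv ℝ u q) (fderiv ℝ w q)) p = 0 := by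
  have hu1 : DifferentiableAt ℝ (fderiv ℝ u) p :=
    (hu.fderiv_right (m := 1) (by norm_num)).differentiableAt one_ne_zero
  have hw1 : DifferentiableAt ℝ (fderiv ℝ w) p :=
    (hw.fderiv_right (m := 1) (by norm_num)).differentiableAt one_ne_zero
  have hd : DifferentiableAt ℝ (fun q => wedgeTwo (fderiv ℝ u q) (fderiv ℝ w q)) p := by
    have h := (ContinuousLinearMap.isBoundedBilinearMap wedgeTwoL).differentiableAt
      (fderiv ℝ u p, fderiv ℝ w p)
    exact h.comp p (hu1.prodMk hw1)
  refine ⟨hd, ?_⟩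
  have hus := hu.isSymmSndFDerivAt (by simp)
  have hws := hw.isSymmSndFDerivAt (by simp)
  ext v
  rw [extDeriv_apply hd]
  refine (Fin.sum_univ_three _).trans ?_
  have hder : ∀ a b : C3, ∀ x : C3,
      fderiv ℝ (fun q => fderiv ℝ u q a * fderiv ℝ w q b - fderiv ℝ u q b * fderiv ℝ w q a) p x =
      fderiv ℝ (fderiv ℝ u) p x a * fderiv ℝ w p b + fderiv ℝ u p a * fderiv ℝ (fderiv ℝ w) p x b -
      (fderiv ℝ (fderiv ℝ u) p x b * fderiv ℝ w p a +
        fderiv ℝ u p b * fderiv ℝ (fderiv ℝ w) p x a) := by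
    intro a b x
    have ha := fun a : C3 => hu1.hasFDerivAt.clm_apply (hasFDerivAt_const a p)
    have hb := fun a : C3 => hw1.hasFDerivAt.clm_apply (hasFDerivAt_const a p)
    have hab : HasFDerivAt (fun q => fderiv ℝ u q a * fderiv ℝ w q b -
      fderiv ℝ u q b * fderiv ℝ w q a) _ p := ((ha a).mul (hb b)).sub ((ha b).mul (hb a))
    rw [hab.fderiv]
    simp
    ring
  obtain ⟨r1, r2, r3, r4, r5, r6⟩ := removeNth_three v
  simp only [wedgeTwo_apply, hder, r1, r2, r3, r4, r5, r6]
  simp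
  -- Only second derivatives of u and w occur in d(du ∧ dw); they cancel by symmetry.
  rw [hus (v 1) (v 0), hus (v 2) (v 0), hus (v 2) (v 1), hws (v 1) (v 0), hws (v 2) (v 0),
    hws (v 2) (v 1)]
  ring

/-- A multiple of `dx_j ∧ dy_j` by a function with differential in the span of `dx_j, dy_j` is
closed. -/
lemma extDeriv_smul_wedgeTwo {g : C3 → ℝ} {p : C3} {j : Fin 3} {a b : ℝ}
    (hg : HasFDerivAt g (a • dRe j + b • dIm j) p) :
    DifferentiableAt ℝ (fun q => g q • wedgeTwo (dRe j) (dIm j)) p ∧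
    extDeriv (fun q => g q • wedgeTwo (dRe j) (dIm j)) p = 0 := by
  have hd : DifferentiableAt ℝ (fun q => g q • wedgeTwo (dRe j) (dIm j)) p :=
    hg.differentiableAt.smul_const _
  refine ⟨hd, ?_⟩
  ext v
  rw [extDeriv_apply hd]
  refine (Fin.sum_univ_three _).trans ?_
  have hder : ∀ (c : ℝ) (x : C3),
      fderiv ℝ (fun q => g q * c) p x = (a * (x j).re + b * (x j).im) * c := by
    intro c x
    rw [(hg.mul_const c).fderiv]
    simp
    ring
  obtain ⟨r1, r2, r3, r4, r5, r6⟩ := removeNth_three v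
  simp only [ContinuousAlternatingMap.smul_apply, smul_eq_mul, hder, wedgeTwo_apply, r1, r2, r3,
    r4, r5, r6]
  simp
  ring

/-! ### The Calabi-Yau structure -/

/-- The differential of the real part of a holomorphic function of `z₀`. -/
lemma hasFDerivAt_re_comp {g : ℂ → ℂ} {p : C3} (hg : DifferentiableAt ℂ g (p 0)) :
    HasFDerivAt (fun q : C3 => (g (q 0)).re)
      ((deriv g (p 0)).re • dRe 0 - (deriv g (p 0)).im • dIm 0) p := by
  have h := (hg.hasDerivAt.hasFDerivAt.restrictScalars ℝ).comp p
    (ContinuousLinearMap.proj (R := ℝ) (φ := fun _ : Fin 3 => ℂ) 0).hasFDerivAt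
  refine (Complex.reCLM.hasFDerivAt.comp p h).congr_fderiv ?_
  ext v
  simp
  ring

/-- The differential of the imaginary part of a holomorphic function of `z₀`. -/
lemma hasFDerivAt_im_comp {g : ℂ → ℂ} {p : C3} (hg : DifferentiableAt ℂ g (p 0)) :
    HasFDerivAt (fun q : C3 => (g (q 0)).im)
      ((deriv g (p 0)).im • dRe 0 + (deriv g (p 0)).re • dIm 0) p := by
  have h := (hg.hasDerivAt.hasFDerivAt.restrictScalars ℝ).comp p
    (ContinuousLinearMap.proj (R := ℝ) (φ := fun _ : Fin 3 => ℂ) 0).hasFDerivAt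
  refine (Complex.imCLM.hasFDerivAt.comp p h).congr_fderiv ?_
  ext v
  simp
  ring

lemma isOpen_strip (r : ℝ) : IsOpen (strip r) :=
  isOpen_lt (by fun_prop) continuous_const

lemma convex_strip (r : ℝ) : Convex ℝ (strip r) := by
  have : strip r = (dIm 0) ⁻¹' (Metric.ball 0 r) := by
    ext p
    simp [strip]
  rw [this]
  exact (convex_ball 0 r).is_linear_preimage (dIm 0).toLinearMap.isLinear

namespace IsPotentialTriple

variable {r : ℝ} {f : Fin 3 → ℂ → ℂ}

lemma deriv_zero (hf : IsPotentialTriple r f) (z : ℂ) : deriv (f 0) z = 0 := by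
  rw [show f 0 = fun _ => 1 from funext hf.zero]
  simp

lemma shear_zero (hf : IsPotentialTriple r f) (p : C3) : shear f p 0 = 0 := by
  simp [shear, hf.deriv_zero]

lemma coframe_zero (hf : IsPotentialTriple r f) (p v : C3) : coframe f p 0 v = v 0 := by
  simp [coframe, hf.shear_zero]

lemma weight_pos (hf : IsPotentialTriple r f) {z : ℂ} (hz : |z.im| < r) (k : Fin 3) :
    0 < weight f z k := by
  have h1 := hf.pos 1 z hz
  have h2 := hf.pos 2 z hz
  fin_cases k <;> simp [weight] <;> positivity

lemma weight_prod (hf : IsPotentialTriple r f) {z : ℂ} (hz : |z.im| < r) :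
    weight f z 0 * weight f z 1 * weight f z 2 = 1 := by
  have h1 := (hf.pos 1 z hz).ne'
  have h2 := (hf.pos 2 z hz).ne'
  simp [weight]
  field_simp

/-- Away from the first index the weights are inverse to the real parts. -/
lemma weight_of_ne (k : Fin 3) (hk : k ≠ 0) (z : ℂ) : weight f z k = ((f k z).re)⁻¹ := by
  fin_cases k
  · exact absurd rfl hk
  · rfl
  · rfl

lemma contDiff_real (hf : IsPotentialTriple r f) (k : Fin 3) : ContDiff ℝ (⊤ : ℕ∞) (f k) :=
  (hf.differentiable k).contDiff.restrict_scalars ℝ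

lemma contDiff_deriv (hf : IsPotentialTriple r f) (k : Fin 3) :
    ContDiff ℝ (⊤ : ℕ∞) (deriv (f k)) := by
  have h : ContDiff ℂ ((⊤ : ℕ∞) + 1) (f k) := (hf.differentiable k).contDiff
  exact (contDiff_succ_iff_deriv.1 h).2.2.restrict_scalars ℝ

lemma periodic_int (hf : IsPotentialTriple r f) (k : Fin 3) (z : ℂ) (n : ℤ) :
    f k (z + n) = f k z := by
  have h : Function.Periodic (f k) 1 := hf.periodic k
  simpa using h.int_mul n z

lemma deriv_periodic_int (hf : IsPotentialTriple r f) (k : Fin 3) (z : ℂ) (n : ℤ) :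
    deriv (f k) (z + n) = deriv (f k) z := by
  rw [← deriv_comp_add_const]
  congr 1
  ext w
  exact hf.periodic_int k w n

/-- Differentiating y_k = m_k Re f_k gives Re f_k dm_k = dy_k - m_k Re(f_k' dz₀), and the right-hand
side is the imaginary part of the coframe form. -/
lemma hasFDerivAt_action (hf : IsPotentialTriple r f) {p : C3} (hp : p ∈ strip r) (k : Fin 3) :
    HasFDerivAt (action f k) (((f k (p 0)).re)⁻¹ • coframeIm f p k) p := by
  have hP := (hf.pos k (p 0) hp).ne'
  have h := ((dIm k).hasFDerivAt (x := p)).mul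
    ((hasDerivAt_inv hP).comp_hasFDerivAt p (hasFDerivAt_re_comp (hf.differentiable k (p 0))))
  refine h.congr_fderiv ?_
  ext v
  simp [coframe, shear, action]
  field_simp
  ring

/-- Together with `hasFDerivAt_action` this says that the coframe form is da_k + i f_k dm_k. -/
lemma hasFDerivAt_angle (hf : IsPotentialTriple r f) {p : C3} (hp : p ∈ strip r) (k : Fin 3) :
    HasFDerivAt (angle f k)
      (coframeRe f p k + ((f k (p 0)).im * ((f k (p 0)).re)⁻¹) • coframeIm f p k) p := by
  have h := ((dRe k).hasFDerivAt (x := p)).add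
    ((hf.hasFDerivAt_action hp k).mul (hasFDerivAt_im_comp (hf.differentiable k (p 0))))
  refine h.congr_fderiv ?_
  ext v
  simp [coframe, shear]
  ring

lemma contDiffOn_action (hf : IsPotentialTriple r f) (k : Fin 3) :
    ContDiffOn ℝ (⊤ : ℕ∞) (action f k) (strip r) := by
  have h := hf.contDiff_real k
  refine ContDiffOn.div ?_ ?_ fun p hp => (hf.pos k (p 0) hp).ne'
  · exact (dIm k).contDiff.contDiffOn
  · exact (Complex.reCLM.contDiff.comp (h.comp (contDiff_apply ℝ ℂ (0 : Fin 3)))).contDiffOn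

lemma contDiffOn_angle (hf : IsPotentialTriple r f) (k : Fin 3) :
    ContDiffOn ℝ (⊤ : ℕ∞) (angle f k) (strip r) := by
  have h := hf.contDiff_real k
  refine ContDiffOn.add (dRe k).contDiff.contDiffOn ((hf.contDiffOn_action k).mul ?_)
  exact (Complex.imCLM.contDiff.comp (h.comp (contDiff_apply ℝ ℂ (0 : Fin 3)))).contDiffOn

lemma contDiffOn_shear (hf : IsPotentialTriple r f) (k : Fin 3) :
    ContDiffOn ℝ (⊤ : ℕ∞) (fun p => shear f p k) (strip r) := by
  refine ContDiffOn.mul (contDiffOn_const.mul ?_) ?_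
  · exact Complex.ofRealCLM.contDiff.comp_contDiffOn (hf.contDiffOn_action k)
  · exact ((hf.contDiff_deriv k).comp (contDiff_apply ℝ ℂ (0 : Fin 3))).contDiffOn

lemma contDiffOn_weight (hf : IsPotentialTriple r f) (k : Fin 3) :
    ContDiffOn ℝ (⊤ : ℕ∞) (fun p : C3 => weight f (p 0) k) (strip r) := by
  have h : ∀ j, ContDiffOn ℝ (⊤ : ℕ∞) (fun p : C3 => (f j (p 0)).re) (strip r) := fun j =>
    (Complex.reCLM.contDiff.comp
      ((hf.contDiff_real j).comp (contDiff_apply ℝ ℂ (0 : Fin 3)))).contDiffOn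
  fin_cases k
  · exact (h 1).mul (h 2)
  · exact (h 1).inv fun p hp => (hf.pos 1 (p 0) hp).ne'
  · exact (h 2).inv fun p hp => (hf.pos 2 (p 0) hp).ne'

lemma contDiffOn_ansatzForm (hf : IsPotentialTriple r f) :
    ContDiffOn ℝ (⊤ : ℕ∞) (ansatzForm f) (strip r) := by
  refine ContDiffOn.sum fun k _ => (hf.contDiffOn_weight k).smul ?_
  have hre : ContDiffOn ℝ (⊤ : ℕ∞) (fun p => (shear f p k).re) (strip r) :=
    Complex.reCLM.contDiff.comp_contDiffOn (hf.contDiffOn_shear k)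
  have him : ContDiffOn ℝ (⊤ : ℕ∞) (fun p => (shear f p k).im) (strip r) :=
    Complex.imCLM.contDiff.comp_contDiffOn (hf.contDiffOn_shear k)
  have hA : ContDiffOn ℝ (⊤ : ℕ∞) (fun p => coframeRe f p k) (strip r) :=
    (contDiffOn_const.sub (hre.smul contDiffOn_const)).add (him.smul contDiffOn_const)
  have hB : ContDiffOn ℝ (⊤ : ℕ∞) (fun p => coframeIm f p k) (strip r) :=
    (contDiffOn_const.sub (hre.smul contDiffOn_const)).sub (him.smul contDiffOn_const)
  exact (wedgeTwoL.contDiff.comp_contDiffOn hA).clm_apply hB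

/-- The Kähler form in action-angle coordinates. -/
lemma ansatzForm_eq (hf : IsPotentialTriple r f) {p : C3} (hp : p ∈ strip r) :
    ansatzForm f p = weight f (p 0) 0 • wedgeTwo (dRe 0) (dIm 0) +
      wedgeTwo (fderiv ℝ (angle f 1) p) (fderiv ℝ (action f 1) p) +
      wedgeTwo (fderiv ℝ (angle f 2) p) (fderiv ℝ (action f 2) p) := by
  -- Since η_k = da_k + i f_k dm_k, the product Re η_k ∧ Im η_k is Re f_k da_k ∧ dm_k, and the
  -- weight removes the factor Re f_k.
  have h : ∀ k, k ≠ 0 → weight f (p 0) k • wedgeTwo (coframeRe f p k) (coframeIm f p k) =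
      wedgeTwo (fderiv ℝ (angle f k) p) (fderiv ℝ (action f k) p) := by
    intro k hk
    rw [(hf.hasFDerivAt_angle hp k).fderiv, (hf.hasFDerivAt_action hp k).fderiv,
      weight_of_ne k hk]
    ext v
    simp
    ring
  rw [ansatzForm, Fin.sum_univ_three, h 1 (by decide), h 2 (by decide)]
  simp [coframeRe, coframeIm, hf.shear_zero]

lemma extDeriv_ansatzForm (hf : IsPotentialTriple r f) {p : C3} (hp : p ∈ strip r) :
    extDeriv (ansatzForm f) p = 0 := by
  have hnhds := (isOpen_strip r).mem_nhds hp
  have heq : ansatzForm f =ᶠ[nhds p] fun q => weight f (q 0) 0 • wedgeTwo (dRe 0) (dIm 0) +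
      wedgeTwo (fderiv ℝ (angle f 1) q) (fderiv ℝ (action f 1) q) +
      wedgeTwo (fderiv ℝ (angle f 2) q) (fderiv ℝ (action f 2) q) := by
    filter_upwards [hnhds] with q hq using hf.ansatzForm_eq hq
  have hc : ∀ k, ContDiffAt ℝ 2 (action f k) p := fun k =>
    ((hf.contDiffOn_action k).contDiffAt hnhds).of_le (WithTop.coe_le_coe.2 le_top)
  have hc' : ∀ k, ContDiffAt ℝ 2 (angle f k) p := fun k =>
    ((hf.contDiffOn_angle k).contDiffAt hnhds).of_le (WithTop.coe_le_coe.2 le_top)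
  obtain ⟨d1, e1⟩ := extDeriv_wedgeTwo_fderiv (hc' 1) (hc 1)
  obtain ⟨d2, e2⟩ := extDeriv_wedgeTwo_fderiv (hc' 2) (hc 2)
  -- The remaining weight Re f₁ Re f₂ depends on z₀ only, so its differential is killed by dx₀ ∧
  -- dy₀.
  have hw := (hasFDerivAt_re_comp (hf.differentiable 1 (p 0))).mul
    (hasFDerivAt_re_comp (hf.differentiable 2 (p 0)))
  set d := deriv (f 1) (p 0)
  set d' := deriv (f 2) (p 0)
  have hw' : HasFDerivAt (fun q : C3 => weight f (q 0) 0)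
      (((f 1 (p 0)).re * d'.re + (f 2 (p 0)).re * d.re) • dRe 0 +
        (-((f 1 (p 0)).re * d'.im + (f 2 (p 0)).re * d.im)) • dIm 0) p := by
    refine hw.congr_fderiv ?_
    ext v
    simp
    ring
  obtain ⟨d0, e0⟩ := extDeriv_smul_wedgeTwo hw'
  rw [heq.extDeriv_eq]
  refine (extDeriv_fun_add (d0.add d1) d2).trans ?_
  rw [extDeriv_add d0 d1, e0, e1, e2]
  simp

lemma isKahlerForm (hf : IsPotentialTriple r f) : IsKahlerForm (strip r) (ansatzForm f) where
  isOpen := isOpen_strip r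
  smooth := hf.contDiffOn_ansatzForm
  closed _ hp := hf.extDeriv_ansatzForm hp
  type_one_one p _ v w := by
    rw [ansatzForm_apply, ansatzForm_apply]
    refine Finset.sum_congr rfl fun k _ => ?_
    rw [coframe_smul, coframe_smul]
    simp
    ring_nf
    simp
  positive p hp v hv := by
    rw [kahlerMetric_ansatzForm]
    have hnn : ∀ k, 0 ≤ weight f (p 0) k * ((coframe f p k v).re * (coframe f p k v).re +
        (coframe f p k v).im * (coframe f p k v).im) := fun k =>
      mul_nonneg (hf.weight_pos hp k).le (add_nonneg (mul_self_nonneg _) (mul_self_nonneg _))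
    refine lt_of_le_of_ne (Finset.sum_nonneg fun k _ => hnn k) fun h0 => hv ?_
    have hz : ∀ k, coframe f p k v = 0 := by
      intro k
      have := (Finset.sum_eq_zero_iff_of_nonneg fun k _ => hnn k).1 h0.symm k (Finset.mem_univ k)
      have h1 := (mul_eq_zero.1 this).resolve_left (hf.weight_pos hp k).ne'
      exact Complex.normSq_eq_zero.1 h1
    -- The coframe is unipotent: its zeroth form is dz₀, and on vectors with v₀ = 0 the others are
    -- dz_k.
    have hv0 : v 0 = 0 := by rw [← hf.coframe_zero p v, hz]
    ext k
    simpa [coframe, hv0] using hz k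

lemma isHolomorphicVolumeForm {U : Set C3} (hU : IsOpen U) :
    IsHolomorphicVolumeForm U (fun _ => stdVolumeForm) where
  isOpen := hU
  holomorphic := differentiableOn_const _
  nonvanishing _ _ h := by
    have := congrArg (fun F : C3 [⋀^Fin 3]→L[ℂ] ℂ => F (fun i => Pi.single i 1)) h
    have h1 : (Matrix.of fun i : Fin 3 => (Pi.single i 1 : C3)) = 1 := by
      ext i j
      simp [Matrix.one_apply, Pi.single_apply, eq_comm]
    simp [stdVolumeForm_apply, h1] at this

lemma action_add_int (hf : IsPotentialTriple r f) (k : Fin 3) (p : C3) (n : Fin 3 → ℤ) :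
    action f k (p + intVecC n) = action f k p := by
  simp [action, intVecC, hf.periodic_int]

lemma isCalabiYau (hr : 0 < r) (hf : IsPotentialTriple r f) :
    IsCalabiYau (strip r) (fun _ => stdVolumeForm) (ansatzForm f) where
  connected := (convex_strip r).isConnected ⟨0, by simpa [strip] using hr⟩
  invariant p hp k := by simpa [strip, intVecC] using hp
  kahler := hf.isKahlerForm
  volume := isHolomorphicVolumeForm (isOpen_strip r)
  kahler_periodic p _ n := by
    have hs : ∀ k, shear f (p + intVecC n) k = shear f p k := by
      intro k
      have : (p + intVecC n) 0 = p 0 + (n 0 : ℂ) := rfl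
      rw [shear, shear, hf.action_add_int, this, hf.deriv_periodic_int]
    have hw : weight f ((p + intVecC n) 0) = weight f (p 0) := by
      have : (p + intVecC n) 0 = p 0 + (n 0 : ℂ) := rfl
      rw [this, weight, weight, hf.periodic_int, hf.periodic_int]
    simp only [ansatzForm, coframeRe, coframeIm, hs, hw]
  volume_periodic _ _ _ := rfl
  relation := calabiYauRelation_of_shear _ _ (fun p => weight f (p 0)) (shear f) (coframeRe f)
    (coframeIm f) (fun _ _ => rfl) (fun _ hp => hf.weight_prod hp) hf.shear_zero
    (fun p k w => coframeRe_apply f p k w) (fun p k w => coframeIm_apply f p k w)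

end IsPotentialTriple

/-! ### The family of special Lagrangian tori -/

/-- The torus on which the action coordinates take the values `m`, parametrized by its angles. -/
def torus (f : Fin 3 → ℂ → ℂ) (m : R3) (x : R3) : C3 :=
  fun k => (x k : ℂ) + Complex.I * (m k * f k (x 0 + Complex.I * m 0))

/-- The standard volume form in terms of a coframe. -/
lemma stdVolumeForm_eq_det_coframe {f : Fin 3 → ℂ → ℂ} {p : C3} (h : shear f p 0 = 0)
    (v : Fin 3 → C3) :
    stdVolumeForm v = (Matrix.of fun i k => coframe f p k (v i)).det := by
  rw [stdVolumeForm_apply, Matrix.det_fin_three, Matrix.det_fin_three]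
  simp [coframe, h]
  ring

namespace IsPotentialTriple

variable {r : ℝ} {f : Fin 3 → ℂ → ℂ}

lemma torus_zero (hf : IsPotentialTriple r f) (m x : R3) :
    torus f m x 0 = x 0 + Complex.I * m 0 := by
  simp [torus, hf.zero]

lemma torus_mem_strip (hf : IsPotentialTriple r f) {m : R3} (hm : |m 0| < r) (x : R3) :
    torus f m x ∈ strip r := by
  simpa [strip, hf.torus_zero] using hm

lemma re_pos_torus (hf : IsPotentialTriple r f) {m : R3} (hm : |m 0| < r) (x : R3) (k : Fin 3) :
    0 < (f k (x 0 + Complex.I * m 0)).re :=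
  hf.pos k _ (by simpa using hm)

lemma action_torus (hf : IsPotentialTriple r f) {m : R3} (hm : |m 0| < r) (x : R3) (k : Fin 3) :
    action f k (torus f m x) = m k := by
  have h := (hf.re_pos_torus hm x k).ne'
  rw [action, hf.torus_zero, div_eq_iff h]
  simp [torus]

lemma angle_torus (hf : IsPotentialTriple r f) {m : R3} (hm : |m 0| < r) (x : R3) (k : Fin 3) :
    angle f k (torus f m x) = x k := by
  rw [angle, hf.action_torus hm, hf.torus_zero]
  simp [torus]

/-- Action-angle coordinates determine the point. -/
lemma torus_action_angle (hf : IsPotentialTriple r f) {p : C3} (hp : p ∈ strip r) :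
    torus f (fun k => action f k p) (fun k => angle f k p) = p := by
  have h0 : ((angle f 0 p : ℝ) : ℂ) + Complex.I * (action f 0 p : ℝ) = p 0 := by
    apply Complex.ext <;> simp [angle, action, hf.zero]
  ext k
  have h := (hf.pos k (p 0) hp).ne'
  rw [torus, h0]
  apply Complex.ext
  · simp [angle]
  · simp [action]
    field_simp

lemma angle_add_int (hf : IsPotentialTriple r f) (k : Fin 3) (p : C3) (n : Fin 3 → ℤ) :
    angle f k (p + intVecC n) = angle f k p + n k := by
  have h0 : (p + intVecC n) 0 = p 0 + (n 0 : ℂ) := rfl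
  rw [angle, angle, hf.action_add_int, h0, hf.periodic_int]
  simp [intVecC]
  ring

lemma contDiff_torus (hf : IsPotentialTriple r f) :
    ContDiff ℝ (⊤ : ℕ∞) (fun q : R3 × R3 => torus f q.1 q.2) := by
  have h1 : ∀ k : Fin 3, ContDiff ℝ (⊤ : ℕ∞) (fun q : R3 × R3 => ((q.1 k : ℝ) : ℂ)) := fun k =>
    Complex.ofRealCLM.contDiff.comp ((contDiff_apply ℝ ℝ k).comp contDiff_fst)
  have h2 : ∀ k : Fin 3, ContDiff ℝ (⊤ : ℕ∞) (fun q : R3 × R3 => ((q.2 k : ℝ) : ℂ)) := fun k =>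
    Complex.ofRealCLM.contDiff.comp ((contDiff_apply ℝ ℝ k).comp contDiff_snd)
  refine contDiff_pi.2 fun k => (h2 k).add (contDiff_const.mul ((h1 k).mul ?_))
  exact (hf.contDiff_real k).comp ((h2 0).add (contDiff_const.mul (h1 0)))

/-- The coframe on the differential of the parametrization. -/
lemma exists_hasFDerivAt_torus (hf : IsPotentialTriple r f) {m : R3} (hm : |m 0| < r) (x : R3) :
    ∃ D : R3 × R3 →L[ℝ] C3, HasFDerivAt (fun q : R3 × R3 => torus f q.1 q.2) D (m, x) ∧
      ∀ dm dx k, coframe f (torus f m x) k (D (dm, dx)) =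
        dx k + Complex.I * (dm k * f k (x 0 + Complex.I * m 0)) := by
  let A : Fin 3 → R3 × R3 →L[ℝ] ℂ := fun k => Complex.ofRealCLM.comp
    ((ContinuousLinearMap.proj (R := ℝ) (φ := fun _ : Fin 3 => ℝ) k).comp
      (ContinuousLinearMap.snd ℝ R3 R3))
  let B : Fin 3 → R3 × R3 →L[ℝ] ℂ := fun k => Complex.ofRealCLM.comp
    ((ContinuousLinearMap.proj (R := ℝ) (φ := fun _ : Fin 3 => ℝ) k).comp
      (ContinuousLinearMap.fst ℝ R3 R3))
  have hA : ∀ k, HasFDerivAt (fun q : R3 × R3 => ((q.2 k : ℝ) : ℂ)) (A k) (m, x) := fun k =>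
    (A k).hasFDerivAt
  have hB : ∀ k, HasFDerivAt (fun q : R3 × R3 => ((q.1 k : ℝ) : ℂ)) (B k) (m, x) := fun k =>
    (B k).hasFDerivAt
  have hz : HasFDerivAt (fun q : R3 × R3 => ((q.2 0 : ℝ) : ℂ) + Complex.I * (q.1 0 : ℝ))
      (A 0 + Complex.I • B 0) (m, x) := (hA 0).add ((hB 0).const_mul Complex.I)
  have hk : ∀ k, HasFDerivAt (fun q : R3 × R3 => torus f q.1 q.2 k)
      (A k + Complex.I • ((m k : ℂ) • (deriv (f k) (x 0 + Complex.I * m 0) •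
        (A 0 + Complex.I • B 0)) + f k (x 0 + Complex.I * m 0) • B k)) (m, x) := by
    intro k
    have h1 : HasDerivAt (f k) (deriv (f k) (x 0 + Complex.I * m 0)) (x 0 + Complex.I * m 0) :=
      (hf.differentiable k _).hasDerivAt
    exact (hA k).add (((hB k).mul (h1.comp_hasFDerivAt (m, x) hz)).const_mul Complex.I)
  refine ⟨ContinuousLinearMap.pi _, hasFDerivAt_pi.2 hk, fun dm dx k => ?_⟩
  simp only [coframe, shear, hf.action_torus hm, hf.torus_zero, ContinuousLinearMap.coe_pi',
    hf.deriv_zero, hf.zero]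
  simp [A, B]
  ring_nf

lemma hasFDerivAt_torus (hf : IsPotentialTriple r f) {m : R3} (hm : |m 0| < r) (x : R3) :
    ∃ D : R3 →L[ℝ] C3, HasFDerivAt (torus f m) D x ∧
      ∀ v k, coframe f (torus f m x) k (D v) = v k := by
  obtain ⟨D, hD, h⟩ := hf.exists_hasFDerivAt_torus hm x
  refine ⟨D.comp (ContinuousLinearMap.inr ℝ R3 R3), ?_, fun v k => ?_⟩
  · exact hD.comp x (hasFDerivAt_prodMk_right m x)
  · simp [h]

lemma coframe_tangent_torus (hf : IsPotentialTriple r f) {m : R3} (hm : |m 0| < r) (x : R3)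
    (i k : Fin 3) :
    coframe f (torus f m x) k (tangent (torus f m) i x) = if i = k then 1 else 0 := by
  obtain ⟨D, hD, h⟩ := hf.hasFDerivAt_torus hm x
  rw [tangent, hD.fderiv, h]
  by_cases hik : i = k
  · simp [e, hik]
  · simp [e, hik, Ne.symm hik]

/-- Along a level set of the actions the coframe restricts to the differentials of the angles, so
its dual frame is the frame of coordinate tangent vectors. -/
lemma inducedMetric_torus (hf : IsPotentialTriple r f) {m : R3} (hm : |m 0| < r) (x : R3) :
    inducedMetric (ansatzForm f) (torus f m) x =
      Matrix.diagonal (weight f (x 0 + Complex.I * m 0)) := by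
  ext i j
  rw [inducedMetric, Matrix.of_apply, kahlerMetric_ansatzForm]
  simp only [hf.coframe_tangent_torus hm, hf.torus_zero]
  fin_cases i <;> fin_cases j <;> simp [Fin.sum_univ_three, Matrix.diagonal]

lemma det_inducedMetric_torus (hf : IsPotentialTriple r f) {m : R3} (hm : |m 0| < r) (x : R3) :
    (inducedMetric (ansatzForm f) (torus f m) x).det = 1 := by
  rw [hf.inducedMetric_torus hm, Matrix.det_diagonal, Fin.prod_univ_three, hf.weight_prod]
  simpa using hm

lemma stdVolumeForm_tangent_torus (hf : IsPotentialTriple r f) {m : R3} (hm : |m 0| < r)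
    (x : R3) : stdVolumeForm ![tangent (torus f m) 0 x, tangent (torus f m) 1 x,
      tangent (torus f m) 2 x] = 1 := by
  have h : (Matrix.of fun i k => coframe f (torus f m x) k (![tangent (torus f m) 0 x,
      tangent (torus f m) 1 x, tangent (torus f m) 2 x] i)) = 1 := by
    ext i k
    fin_cases i <;> simp [hf.coframe_tangent_torus hm, Matrix.one_apply]
  rw [stdVolumeForm_eq_det_coframe (hf.shear_zero _), h, Matrix.det_one]

/-- All the coframe forms are real on the tangent vectors, so the Kähler form vanishes and the
volume form is the determinant of the identity. The weights have product 1, so the induced volume is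
1 as well. Embeddedness follows from the equivariance of the angles. -/
lemma isSLagTorus_torus (hf : IsPotentialTriple r f) {m : R3} (hm : |m 0| < r) :
    IsSLagTorus (strip r) (fun _ => stdVolumeForm) (ansatzForm f) (torus f m) where
  smooth := hf.contDiff_torus.comp (contDiff_const.prodMk contDiff_id)
  mem := hf.torus_mem_strip hm
  equivariant x n := by
    ext k
    have h : (((x + intVec n) 0 : ℝ) : ℂ) + Complex.I * m 0 = (x 0 + Complex.I * m 0) + n 0 := by
      simp [intVec]
      ring
    simp only [torus, h, hf.periodic_int]
    simp [torus, intVec, intVecC]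
    ring
  immersion x := by
    obtain ⟨D, hD, h⟩ := hf.hasFDerivAt_torus hm x
    rw [hD.fderiv]
    refine (injective_iff_map_eq_zero D).2 fun v hv => ?_
    ext k
    have := h v k
    rw [hv] at this
    simpa [coframe] using this.symm
  injective x x' n h := by
    ext k
    have := congrArg (angle f k) h
    rwa [hf.angle_add_int, hf.angle_torus hm, hf.angle_torus hm] at this
  lagrangian x i j := by
    rw [ansatzForm_apply]
    refine Finset.sum_eq_zero fun k _ => ?_
    rw [hf.coframe_tangent_torus hm, hf.coframe_tangent_torus hm]
    split_ifs <;> simp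
  im_eq_zero x := by simp [hf.stdVolumeForm_tangent_torus hm]
  re_eq_vol x := by simp [hf.stdVolumeForm_tangent_torus hm, hf.det_inducedMetric_torus hm]

/-- Distinct action coordinates give distinct tori. -/
lemma eq_of_range_torus_eq (hf : IsPotentialTriple r f) {m m' : R3} (hm : |m 0| < r)
    (hm' : |m' 0| < r) (h : Set.range (torus f m) = Set.range (torus f m')) : m = m' := by
  obtain ⟨y, hy⟩ : torus f m 0 ∈ Set.range (torus f m') := h ▸ Set.mem_range_self 0
  ext k
  rw [← hf.action_torus hm 0 k, ← hy, hf.action_torus hm' y k]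

end IsPotentialTriple

/-! ### Calculus on the 3-torus -/

open MeasureTheory Filter in
/-- The divergence theorem on the torus. -/
lemma integral_divergence_of_periodic (Y : Fin 3 → R3 → ℝ) (hY : ∀ i, ContDiff ℝ 1 (Y i))
    (hper : ∀ i x, ∀ n : Fin 3 → ℤ, Y i (x + intVec n) = Y i x) (a : R3) :
    ∫ x in Set.Icc a (a + 1), ∑ i, fderiv ℝ (Y i) x (e i) = 0 := by
  have hcont : Continuous fun x => ∑ i, fderiv ℝ (Y i) x (e i) :=
    continuous_finsetSum _ fun i _ =>
      ((hY i).continuous_fderiv one_ne_zero).clm_apply continuous_const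
  have h := integral_divergence_of_hasFDerivAt_off_countable' a (a + 1)
    (le_add_of_nonneg_right zero_le_one) Y (fun i => fderiv ℝ (Y i)) ∅ Set.countable_empty
    (fun i => (hY i).continuous.continuousOn)
    (fun x _ i => ((hY i).differentiable one_ne_zero x).hasFDerivAt)
    (hcont.integrableOn_Icc)
  refine h.trans (Finset.sum_eq_zero fun i _ => sub_eq_zero.2 ?_)
  congr 1
  ext y
  -- Opposite faces of the cube differ by an integral translation, so their contributions cancel.
  rw [← hper i (i.insertNth (a i) y) (Pi.single i 1)]
  congr 1
  ext j
  by_cases hj : j = i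
  · subst hj
    simp [intVec]
  · obtain ⟨k, rfl⟩ := Fin.exists_succAbove_eq hj
    simp [intVec]

open MeasureTheory in
/-- A periodic vector field whose divergence has a sign is divergence free. -/
lemma divergence_eq_zero_of_nonneg (Y : Fin 3 → R3 → ℝ) (hY : ∀ i, ContDiff ℝ 1 (Y i))
    (hper : ∀ i x, ∀ n : Fin 3 → ℤ, Y i (x + intVec n) = Y i x)
    (hnn : ∀ x, 0 ≤ ∑ i, fderiv ℝ (Y i) x (e i)) (x : R3) :
    ∑ i, fderiv ℝ (Y i) x (e i) = 0 := by
  have hcont : Continuous fun x => ∑ i, fderiv ℝ (Y i) x (e i) :=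
    continuous_finsetSum _ fun i _ =>
      ((hY i).continuous_fderiv one_ne_zero).clm_apply continuous_const
  -- Centering the unit cube at x puts x in its interior, where vanishing almost everywhere and
  -- continuity give vanishing.
  let a : R3 := fun i => x i - 1 / 2
  have h0 := integral_divergence_of_periodic Y hY hper a
  rw [setIntegral_eq_zero_iff_of_nonneg_ae (Filter.Eventually.of_forall hnn)
    hcont.integrableOn_Icc] at h0
  let S : Set R3 := Set.univ.pi fun i => Set.Ioo (a i) (a i + 1)
  have hS : IsOpen S := isOpen_set_pi Set.finite_univ fun _ _ => isOpen_Ioo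
  have hsub : S ⊆ Set.Icc a (a + 1) := fun y hy =>
    ⟨fun i => (hy i trivial).1.le, fun i => (hy i trivial).2.le⟩
  have hx : x ∈ S := fun i _ => ⟨by simp [a], by simp [a]; linarith⟩
  exact Measure.eqOn_open_of_ae_eq (ae_restrict_of_ae_restrict_of_subset hsub h0) hS
    hcont.continuousOn continuousOn_const hx

open Filter in
/-- A local diffeomorphism of `ℝ³` which commutes with integral translations is onto. -/
lemma surjective_of_equivariant {H : R3 → R3} (hH : ContDiff ℝ 1 H)
    (hinj : ∀ x, Function.Injective (fderiv ℝ H x))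
    (heq : ∀ x, ∀ n : Fin 3 → ℤ, H (x + intVec n) = H x + intVec n) :
    Function.Surjective H := by
  have hopen : IsOpenMap H := by
    refine isOpenMap_iff_nhds_le.2 fun x => ?_
    have hs : HasStrictFDerivAt H (fderiv ℝ H x) x :=
      hH.contDiffAt.hasStrictFDerivAt one_ne_zero
    refine (hs.map_nhds_eq_of_surj ?_).ge
    exact LinearMap.range_eq_top.2 (LinearMap.injective_iff_surjective.1 (hinj x))
  -- The displacement H - id is periodic, hence bounded. Thus H is proper, and its range is both
  -- closed and open.
  obtain ⟨C, hC⟩ : ∃ C, ∀ x, ‖H x - x‖ ≤ C := by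
    obtain ⟨C, hC⟩ := (isCompact_Icc (a := (0 : R3)) (b := 1)).exists_bound_of_continuousOn
      (f := fun x => H x - x) (hH.continuous.sub continuous_id).continuousOn
    refine ⟨C, fun x => ?_⟩
    let y : R3 := fun i => Int.fract (x i)
    have hy : x = y + intVec (fun i => ⌊x i⌋) := by
      ext i
      simp [y, intVec]
    have h1 := hC y ⟨fun i => Int.fract_nonneg _, fun i => (Int.fract_lt_one _).le⟩
    rw [hy, heq]
    simpa using h1
  have hproper : IsProperMap H := by
    refine isProperMap_iff_tendsto_cocompact.2 ⟨hH.continuous, ?_⟩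
    rw [← Metric.cobounded_eq_cocompact, ← tendsto_norm_atTop_iff_cobounded]
    refine tendsto_atTop_mono (f := fun x : R3 => ‖x‖ - C) (fun x => ?_)
      (tendsto_atTop_add_const_right _ _ tendsto_norm_cobounded_atTop)
    have h2 : ‖x‖ ≤ ‖H x‖ + ‖H x - x‖ := by
      have h3 := norm_sub_le (H x) (H x - x)
      rwa [sub_sub_cancel] at h3
    linarith [hC x]
  have hclopen : IsClopen (Set.range H) := ⟨hproper.isClosedMap.isClosed_range, hopen.isOpen_range⟩
  exact Set.range_eq_univ.1 (hclopen.eq_univ (Set.range_nonempty H))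

/-! ### Cofactors of a Jacobian matrix -/

/-- With cyclic indices modulo 3 the cofactors carry no signs, which makes the divergence
computation symmetric. -/
lemma adjugate_fin_three_apply {R : Type*} [CommRing R] (M : Matrix (Fin 3) (Fin 3) R)
    (k i : Fin 3) :
    M.adjugate k i = M (i + 1) (k + 1) * M (i + 2) (k + 2) - M (i + 1) (k + 2) * M (i + 2) (k + 1) := by
  rw [Matrix.adjugate_fin_three]
  fin_cases k <;> fin_cases i <;> simp <;> ring

/-- The matrix whose rows are the coordinate tangent vectors. -/
def jacobian (G : R3 → C3) (x : R3) : Matrix (Fin 3) (Fin 3) ℂ :=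
  Matrix.of fun i j => tangent G i x j

lemma hasFDerivAt_jacobian {G : R3 → C3} (hG : ContDiff ℝ 2 G) (x : R3) (i j : Fin 3) :
    ∃ L : R3 →L[ℝ] ℂ, HasFDerivAt (fun y => jacobian G y i j) L x ∧
      ∀ v, L v = fderiv ℝ (fderiv ℝ G) x v (e i) j := by
  have h1 : DifferentiableAt ℝ (fderiv ℝ G) x :=
    (hG.contDiffAt.fderiv_right (m := 1) (by norm_num)).differentiableAt one_ne_zero
  have h2 := hasFDerivAt_pi'.1 (h1.hasFDerivAt.clm_apply (hasFDerivAt_const (e i) x)) j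
  exact ⟨_, h2, fun v => by simp⟩

/-- The rows of the cofactor matrix of a Jacobian are divergence free. -/
lemma divergence_adjugate_jacobian {G : R3 → C3} (hG : ContDiff ℝ 2 G) (x : R3) (k : Fin 3) :
    ∑ i, fderiv ℝ (fun y => (jacobian G y).adjugate k i) x (e i) = 0 := by
  choose L hL hLv using hasFDerivAt_jacobian hG x
  have hsymm : ∀ l i j, L i j (e l) = L l j (e i) := by
    intro l i j
    rw [hLv, hLv, (hG.contDiffAt (x := x)).isSymmSndFDerivAt (by simp) (e l) (e i)]
  have hd : ∀ i, fderiv ℝ (fun y => (jacobian G y).adjugate k i) x (e i) =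
      jacobian G x (i + 1) (k + 1) * L (i + 2) (k + 2) (e i) +
        jacobian G x (i + 2) (k + 2) * L (i + 1) (k + 1) (e i) -
      (jacobian G x (i + 1) (k + 2) * L (i + 2) (k + 1) (e i) +
        jacobian G x (i + 2) (k + 1) * L (i + 1) (k + 2) (e i)) := by
    intro i
    simp only [adjugate_fin_three_apply]
    have h : HasFDerivAt (fun y => jacobian G y (i + 1) (k + 1) * jacobian G y (i + 2) (k + 2) -
        jacobian G y (i + 1) (k + 2) * jacobian G y (i + 2) (k + 1)) _ x :=
      ((hL (i + 1) (k + 1)).mul (hL (i + 2) (k + 2))).sub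
        ((hL (i + 1) (k + 2)).mul (hL (i + 2) (k + 1)))
    rw [h.fderiv]
    simp
  simp only [hd, Fin.sum_univ_three]
  have e1 : (0 : Fin 3) + 1 = 1 := rfl
  have e2 : (0 : Fin 3) + 2 = 2 := rfl
  have e3 : (1 : Fin 3) + 1 = 2 := rfl
  have e4 : (1 : Fin 3) + 2 = 0 := rfl
  have e5 : (2 : Fin 3) + 1 = 0 := rfl
  have e6 : (2 : Fin 3) + 2 = 1 := rfl
  simp only [e1, e2, e3, e4, e5, e6]
  -- The Piola identity: the second derivatives cancel in pairs by symmetry.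
  rw [hsymm 1 0, hsymm 2 0, hsymm 2 1, hsymm 1 0, hsymm 2 0, hsymm 2 1]
  ring

/-! ### Uniqueness of special Lagrangian tori -/

/-- The Hermitian metric whose real part is the Kähler metric. -/
def hermForm (f : Fin 3 → ℂ → ℂ) (p v w : C3) : ℂ :=
  ∑ k, (weight f (p 0) k : ℂ) * (coframe f p k v * starRingEnd ℂ (coframe f p k w))

lemma ansatzForm_eq_neg_im (f : Fin 3 → ℂ → ℂ) (p v w : C3) :
    ansatzForm f p ![v, w] = -(hermForm f p v w).im := by
  rw [ansatzForm_apply]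
  simp [hermForm, Fin.sum_univ_three]
  ring

lemma kahlerMetric_eq_re (f : Fin 3 → ℂ → ℂ) (p v w : C3) :
    kahlerMetric (ansatzForm f p) v w = (hermForm f p v w).re := by
  rw [kahlerMetric_ansatzForm]
  simp [hermForm, Fin.sum_univ_three]

lemma hermForm_sum_left (f : Fin 3 → ℂ → ℂ) (p w : C3) (a : Fin 3 → ℂ) (T : Fin 3 → C3) :
    hermForm f p (∑ j, a j • T j) w = ∑ j, a j * hermForm f p (T j) w := by
  simp only [hermForm, coframe_sum, coframe_smul]
  simp only [Fin.sum_univ_three]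
  ring

lemma hermForm_sum_right (f : Fin 3 → ℂ → ℂ) (p v : C3) (b : Fin 3 → ℝ) (T : Fin 3 → C3) :
    hermForm f p v (∑ j, (b j : ℂ) • T j) = ∑ j, (b j : ℂ) * hermForm f p v (T j) := by
  simp only [hermForm, coframe_sum, coframe_smul]
  simp only [Fin.sum_univ_three, map_add, map_mul, Complex.conj_ofReal]
  ring

/-- For a Lagrangian frame `T`, pairing a vector with its imaginary components in the frame gives
minus the squared length of the imaginary part. -/
lemma ansatzForm_lagrangian_frame {f : Fin 3 → ℂ → ℂ} {p : C3} {T : Fin 3 → C3}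
    (hlag : ∀ i j, ansatzForm f p ![T i, T j] = 0) {D : ℝ} {a : Fin 3 → ℂ} {u : C3}
    (hu : ∑ i, a i • T i = (D : ℂ) • u) :
    (∀ i, D * ansatzForm f p ![u, T i] = -∑ j, (a j).im * (hermForm f p (T j) (T i)).re) ∧
    D * ∑ i, (a i).im * ansatzForm f p ![u, T i] =
      -kahlerMetric (ansatzForm f p) (∑ i, ((a i).im : ℂ) • T i) (∑ i, ((a i).im : ℂ) • T i) := by
  -- On a Lagrangian frame the Hermitian form is real, so taking the imaginary part of its pairing
  -- with `hu` only sees the imaginary parts of the coefficients.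
  have him : ∀ i j, (hermForm f p (T i) (T j)).im = 0 := fun i j => by
    have := hlag i j
    rw [ansatzForm_eq_neg_im] at this
    linarith
  have h1 : ∀ i, D * ansatzForm f p ![u, T i] =
      -∑ j, (a j).im * (hermForm f p (T j) (T i)).re := by
    intro i
    have h2 : hermForm f p (∑ j, a j • T j) (T i) = D * hermForm f p u (T i) := by
      rw [hu]
      simp only [hermForm, coframe_smul, Fin.sum_univ_three]
      ring
    rw [hermForm_sum_left] at h2
    have h3 := congrArg Complex.im h2
    simp only [Complex.im_sum, Complex.mul_im, him, Complex.ofReal_re, Complex.ofReal_im,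
      mul_zero, zero_mul, add_zero, zero_add] at h3
    rw [ansatzForm_eq_neg_im]
    linarith
  refine ⟨h1, ?_⟩
  rw [Finset.mul_sum, kahlerMetric_eq_re, hermForm_sum_right]
  simp only [hermForm_sum_left]
  have h4 : ∀ i, D * ((a i).im * ansatzForm f p ![u, T i]) =
      (a i).im * (-∑ j, (a j).im * (hermForm f p (T j) (T i)).re) := fun i => by
    rw [← h1 i]
    ring
  simp only [h4, Complex.re_sum, Complex.re_ofReal_mul, mul_neg, Finset.sum_neg_distrib]

lemma tangent_add_int {U : Set C3} {Ω : C3 → C3 [⋀^Fin 3]→L[ℂ] ℂ}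
    {ω : C3 → C3 [⋀^Fin 2]→L[ℝ] ℝ} {G : R3 → C3} (hG : IsSLagTorus U Ω ω G) (i : Fin 3) (x : R3)
    (n : Fin 3 → ℤ) : tangent G i (x + intVec n) = tangent G i x := by
  have h : (fun y => G (y + intVec n)) = fun y => G y + intVecC n :=
    funext fun y => hG.equivariant y n
  rw [tangent, tangent, ← fderiv_comp_add_right, h, fderiv_add_const]

namespace IsPotentialTriple

variable {r : ℝ} {f : Fin 3 → ℂ → ℂ}

/-- The differential of an action coordinate is the contraction of the Kähler form with the
corresponding translation. -/
lemma fderiv_action_eq (hf : IsPotentialTriple r f) {p : C3} (hp : p ∈ strip r) {k : Fin 3}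
    (hk : k ≠ 0) (v : C3) :
    fderiv ℝ (action f k) p v = ansatzForm f p ![Pi.single k 1, v] := by
  have h : ∀ j, coframe f p j (Pi.single k 1) = if j = k then 1 else 0 := by
    intro j
    simp [coframe, Pi.single_apply, hk.symm]
  rw [(hf.hasFDerivAt_action hp k).fderiv, ansatzForm_apply, Finset.sum_eq_single k]
  · rw [h, if_pos rfl, weight_of_ne k hk]
    simp
  · intro j _ hj
    rw [h, if_neg hj]
    simp
  · simp

/-- On a special Lagrangian torus close to the base torus the second and third action coordinates
are constant, and the corresponding translations are tangent. -/
lemma action_comp_slag (hf : IsPotentialTriple r f) {G : R3 → C3}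
    (hG : IsSLagTorus (strip r) (fun _ => stdVolumeForm) (ansatzForm f) G)
    (hdet : ∀ x, (jacobian G x).det ≠ 0) {k : Fin 3} (hk : k ≠ 0) (x : R3) :
    (∀ i, ((jacobian G x).adjugate k i).im = 0) ∧ fderiv ℝ (fun y => action f k (G y)) x = 0 := by
  have hG2 : ContDiff ℝ 2 G := hG.smooth.of_le (WithTop.coe_le_coe.2 le_top)
  have hmat : ∀ x, jacobian G x = Matrix.of ![tangent G 0 x, tangent G 1 x, tangent G 2 x] := by
    intro x
    ext i j
    fin_cases i <;> rfl
  have hdetv : ∀ x, stdVolumeForm ![tangent G 0 x, tangent G 1 x, tangent G 2 x] =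
      (jacobian G x).det := fun x => by rw [stdVolumeForm_apply, hmat]
  have hdre : ∀ x, (((jacobian G x).det.re : ℝ) : ℂ) = (jacobian G x).det := by
    intro x
    apply Complex.ext
    · simp
    · have := hG.im_eq_zero x
      rw [hdetv] at this
      simp [this]
  -- The special Lagrangian condition makes the determinant real and equal to a square root, hence
  -- nonnegative; `hdet` excludes zero.
  have hdpos : ∀ x, 0 < (jacobian G x).det.re := by
    intro x
    have h1 := hG.re_eq_vol x
    rw [hdetv] at h1
    refine lt_of_le_of_ne (h1 ▸ Real.sqrt_nonneg _) fun h0 => hdet x ?_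
    rw [← hdre, ← h0]
    simp
  -- Cramer's rule: up to the factor det, row k of the adjugate lists the complex coefficients of
  -- the k-th translation field in the tangent frame. Its imaginary part measures the failure of
  -- that field to be tangent.
  have hu : ∀ x, ∑ i, (jacobian G x).adjugate k i • tangent G i x =
      ((jacobian G x).det.re : ℂ) • (Pi.single k 1 : C3) := by
    intro x
    ext j
    have := congrFun (congrFun (Matrix.adjugate_mul (jacobian G x)) k) j
    rw [Matrix.mul_apply] at this
    rw [hdre]
    simp only [Finset.sum_apply, Pi.smul_apply, smul_eq_mul]
    refine this.trans ?_
    simp [Matrix.one_apply, Pi.single_apply, eq_comm]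
  have hact : ContDiff ℝ (⊤ : ℕ∞) (fun y => action f k (G y)) :=
    contDiff_iff_contDiffAt.2 fun y =>
      ((hf.contDiffOn_action k).contDiffAt ((isOpen_strip r).mem_nhds (hG.mem y))).comp y
        hG.smooth.contDiffAt
  have hactd : ∀ x i, fderiv ℝ (fun y => action f k (G y)) x (e i) =
      ansatzForm f (G x) ![Pi.single k 1, tangent G i x] := by
    intro x i
    have h1 := (hf.hasFDerivAt_action (hG.mem x) k).differentiableAt.hasFDerivAt.comp x
      (hG2.differentiable two_ne_zero x).hasFDerivAt
    rw [← hf.fderiv_action_eq (hG.mem x) hk]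
    exact congrArg (fun L => L (e i)) h1.fderiv
  have hjac : ∀ i j, ContDiff ℝ 1 (fun y => jacobian G y i j) := by
    intro i j
    have h1 : ContDiff ℝ 1 (fun y => tangent G i y) :=
      (hG2.fderiv_right (m := 1) (by norm_num)).clm_apply contDiff_const
    exact contDiff_pi.1 h1 j
  have hadj : ∀ i, ContDiff ℝ 1 (fun y => (jacobian G y).adjugate k i) := by
    intro i
    simp only [adjugate_fin_three_apply]
    exact ((hjac _ _).mul (hjac _ _)).sub ((hjac _ _).mul (hjac _ _))
  -- As the cofactors are divergence free, the divergence of this field only involves the derivative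
  -- of the action. By `ansatzForm_lagrangian_frame`, det times that divergence is the squared
  -- length of Σ Im(adj_{ki}) T_i.
  let Y : Fin 3 → R3 → ℝ := fun i y => -(action f k (G y) * ((jacobian G y).adjugate k i).im)
  have hadjim : ∀ i, ContDiff ℝ 1 (fun y => ((jacobian G y).adjugate k i).im) := fun i =>
    Complex.imCLM.contDiff.comp (hadj i)
  have hact1 : ContDiff ℝ 1 (fun y => action f k (G y)) :=
    hact.of_le (WithTop.coe_le_coe.2 le_top)
  have hY : ∀ i, ContDiff ℝ 1 (Y i) := fun i => (hact1.mul (hadjim i)).neg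
  have hper : ∀ i x, ∀ n : Fin 3 → ℤ, Y i (x + intVec n) = Y i x := by
    intro i x n
    have h1 : jacobian G (x + intVec n) = jacobian G x := by
      ext i j
      simp only [jacobian, Matrix.of_apply, tangent_add_int hG]
    simp only [Y, h1, hG.equivariant, hf.action_add_int]
  have hdiv : ∀ x, ∑ i, fderiv ℝ (Y i) x (e i) = -∑ i, ((jacobian G x).adjugate k i).im *
      ansatzForm f (G x) ![Pi.single k 1, tangent G i x] := by
    intro x
    have h1 : ∀ i, fderiv ℝ (Y i) x (e i) = -(action f k (G x) *
        (fderiv ℝ (fun y => (jacobian G y).adjugate k i) x (e i)).im +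
        ((jacobian G x).adjugate k i).im *
          ansatzForm f (G x) ![Pi.single k 1, tangent G i x]) := by
      intro i
      have h2 := (hact1.differentiable one_ne_zero x).hasFDerivAt
      have h3 : HasFDerivAt (fun y => ((jacobian G y).adjugate k i).im)
          (Complex.imCLM.comp (fderiv ℝ (fun y => (jacobian G y).adjugate k i) x)) x :=
        Complex.imCLM.hasFDerivAt.comp x ((hadj i).differentiable one_ne_zero x).hasFDerivAt
      have h4 : HasFDerivAt (Y i) _ x := (h2.mul h3).neg
      rw [h4.fderiv, ← hactd]
      simp
    simp only [h1, Finset.sum_neg_distrib, Finset.sum_add_distrib, ← Finset.mul_sum,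
      ← Complex.im_sum, divergence_adjugate_jacobian hG2]
    simp
  have hframe := fun x => ansatzForm_lagrangian_frame (T := fun i => tangent G i x)
    (hG.lagrangian x) (hu x)
  have hpos := fun x v => hf.isKahlerForm.positive (G x) (hG.mem x) v
  have hnn : ∀ x v, 0 ≤ kahlerMetric (ansatzForm f (G x)) v v := by
    intro x v
    by_cases hv : v = 0
    · rw [kahlerMetric_ansatzForm, hv]
      simp [coframe]
    · exact (hpos x v hv).le
  have hdivnn : ∀ x, 0 ≤ ∑ i, fderiv ℝ (Y i) x (e i) := by
    intro x
    rw [hdiv]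
    have h1 := (hframe x).2
    have h2 := hnn x (∑ i, (((jacobian G x).adjugate k i).im : ℂ) • tangent G i x)
    by_contra hneg
    push Not at hneg
    nlinarith [mul_pos_of_neg_of_neg hneg (neg_lt_zero.2 (hdpos x))]
  have hzero := divergence_eq_zero_of_nonneg Y hY hper hdivnn x
  rw [hdiv, neg_eq_zero] at hzero
  have h5 := (hframe x).2
  rw [hzero, mul_zero, eq_comm, neg_eq_zero] at h5
  have hW : ∑ i, (((jacobian G x).adjugate k i).im : ℂ) • tangent G i x = 0 := by
    -- The squared length of this vector vanishes. The tangent frame is independent over ℂ, so every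
    -- coefficient vanishes.
    by_contra hne
    exact (hpos x _ hne).ne' h5
  have him : ∀ i, ((jacobian G x).adjugate k i).im = 0 := by
    intro i
    have h6 : Matrix.vecMul (fun i => (((jacobian G x).adjugate k i).im : ℂ)) (jacobian G x) = 0 := by
      ext j
      have := congrFun hW j
      simpa [Matrix.vecMul, dotProduct, jacobian] using this
    have := congrFun (Matrix.eq_zero_of_vecMul_eq_zero (hdet x) h6) i
    exact Complex.ofReal_eq_zero.1 this
  refine ⟨him, ?_⟩
  have hbasis : ∀ i, fderiv ℝ (fun y => action f k (G y)) x (e i) = 0 := by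
    intro i
    have h7 := (hframe x).1 i
    simp only [him, zero_mul, Finset.sum_const_zero, neg_zero] at h7
    rw [hactd]
    exact (mul_eq_zero.1 h7).resolve_left (hdpos x).ne'
  refine ContinuousLinearMap.coe_injective ((Pi.basisFun ℝ (Fin 3)).ext fun i => ?_)
  simpa [e] using hbasis i

/-- Every special Lagrangian torus with nondegenerate Jacobian is a level set of the actions. -/
lemma exists_range_eq_range_torus (hf : IsPotentialTriple r f) {G : R3 → C3}
    (hG : IsSLagTorus (strip r) (fun _ => stdVolumeForm) (ansatzForm f) G)
    (hdet : ∀ x, (jacobian G x).det ≠ 0) :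
    ∃ m : R3, |m 0| < r ∧ Set.range G = Set.range (torus f m) := by
  have hG1 : Differentiable ℝ G := hG.smooth.differentiable (by simp)
  have hGd : ∀ k x, DifferentiableAt ℝ (fun y => action f k (G y)) x := fun k x =>
    (hf.hasFDerivAt_action (hG.mem x) k).differentiableAt.comp x (hG1 x)
  have hconst : ∀ k x, action f k (G x) = action f k (G 0) := by
    intro k x
    refine is_const_of_fderiv_eq_zero (𝕜 := ℝ) (f := fun y => action f k (G y)) (hGd k)
      (fun x => ?_) x 0
    by_cases hk : k = 0
    · subst hk
      have hadj := fun k hk => (hf.action_comp_slag hG hdet (k := k) hk x).1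
      have h0 : ∀ i, (tangent G i x 0).im = 0 := by
        intro i
        -- In dimension 3, adj(adj J) = det J · J. Its column 0 is made of minors of rows 1 and 2 of
        -- adj J, which are real by `hadj`; as det J is real and nonzero, the z₀-components of the
        -- tangent vectors are real.
        have h1 := congrFun (congrFun (Matrix.adjugate_adjugate (jacobian G x) (by simp)) i) 0
        rw [adjugate_fin_three_apply] at h1
        simp only [Fintype.card_fin, Matrix.smul_apply, smul_eq_mul, show 3 - 2 = 1 from rfl,
          pow_one] at h1
        have h2 := congrArg Complex.im h1
        have hdim : ((jacobian G x).det).im = 0 := by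
          have h3 := hG.im_eq_zero x
          rw [stdVolumeForm_apply] at h3
          convert h3 using 3
          ext i j
          fin_cases i <;> rfl
        have hdre : ((jacobian G x).det).re ≠ 0 := fun h => hdet x (Complex.ext h hdim)
        have e1 : (0 : Fin 3) + 1 = 1 := rfl
        have e2 : (0 : Fin 3) + 2 = 2 := rfl
        simp only [e1, e2, Complex.sub_im, Complex.mul_im, hadj 1 (by decide),
          hadj 2 (by decide), mul_zero, zero_mul, add_zero, sub_zero, hdim] at h2
        exact (mul_eq_zero.1 h2.symm).resolve_left hdre
      have h1 := (hf.hasFDerivAt_action (hG.mem x) 0).comp x (hG1 x).hasFDerivAt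
      have h2 : HasFDerivAt (fun y => action f 0 (G y)) _ x := h1
      rw [h2.fderiv]
      refine ContinuousLinearMap.coe_injective ((Pi.basisFun ℝ (Fin 3)).ext fun i => ?_)
      have := h0 i
      simp only [tangent, e] at this
      simp [hf.coframe_zero, this]
    · exact (hf.action_comp_slag hG hdet hk x).2
  let m : R3 := fun k => action f k (G 0)
  have hm : |m 0| < r := by
    have := hG.mem 0
    simpa [m, action, hf.zero, strip] using this
  let H : R3 → R3 := fun x k => angle f k (G x)
  have hGH : ∀ x, G x = torus f m (H x) := by
    intro x
    have h1 := hf.torus_action_angle (hG.mem x)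
    simp only [hconst _ x] at h1
    exact h1.symm
  have hH : ContDiff ℝ 1 H := contDiff_pi.2 fun k => contDiff_iff_contDiffAt.2 fun y =>
    (((hf.contDiffOn_angle k).contDiffAt ((isOpen_strip r).mem_nhds (hG.mem y))).comp y
      hG.smooth.contDiffAt).of_le (WithTop.coe_le_coe.2 le_top)
  -- `hGH` puts the image of G inside the level set; the image is the whole level set once the angle
  -- map is onto.
  have hsurj : Function.Surjective H := by
    refine surjective_of_equivariant hH (fun x => ?_) fun x n => ?_
    · obtain ⟨D, hD, -⟩ := hf.hasFDerivAt_torus hm (H x)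
      have h1 : HasFDerivAt G (D.comp (fderiv ℝ H x)) x := by
        have h2 := hD.comp x (hH.differentiable one_ne_zero x).hasFDerivAt
        exact h2.congr_of_eventuallyEq (Filter.Eventually.of_forall hGH)
      have h3 := hG.immersion x
      rw [h1.fderiv] at h3
      exact Function.Injective.of_comp (f := D) h3
    · ext k
      simp [H, hG.equivariant, hf.angle_add_int, intVec]
  refine ⟨m, hm, Set.Subset.antisymm ?_ ?_⟩
  · rintro _ ⟨x, rfl⟩
    exact ⟨H x, (hGH x).symm⟩
  · rintro _ ⟨y, rfl⟩
    obtain ⟨x, rfl⟩ := hsurj y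
    exact ⟨x, hGH x⟩

end IsPotentialTriple

/-! ### The local moduli space -/

/-- A triple of potentials for which the periods of the Kähler form over the tori are explicit. -/
structure IsNormalizedTriple (r : ℝ) (f : Fin 3 → ℂ → ℂ) : Prop extends IsPotentialTriple r f where
  integral_weight : ∀ t : ℝ, ∫ s in (0 : ℝ)..1, weight f (s + Complex.I * t) 0 =
    Real.exp (-(4 * Real.pi * t))
  integral_re : ∀ k, ∀ t : ℝ, ∫ s in (0 : ℝ)..1, (f k (s + Complex.I * t)).re = 1

/-- The action coordinates in terms of the affine coordinates. -/
def actionOf (u : R3) : R3 :=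
  ![-Real.log (1 + 4 * Real.pi * u 0) / (4 * Real.pi), -u 1, -u 2]

/-- The affine coordinates in terms of the action coordinates. -/
def affineOf (m : R3) : R3 :=
  ![(Real.exp (-(4 * Real.pi * m 0)) - 1) / (4 * Real.pi), -m 1, -m 2]

/-- The range of the affine coordinates. -/
def moduliBase (r : ℝ) : Set R3 :=
  {u | u 0 ∈ Set.Ioo ((Real.exp (-(4 * Real.pi * r)) - 1) / (4 * Real.pi))
    ((Real.exp (4 * Real.pi * r) - 1) / (4 * Real.pi))}

lemma four_pi_pos : 0 < 4 * Real.pi := by positivity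

lemma mem_moduliBase_iff {r : ℝ} {u : R3} : u ∈ moduliBase r ↔
    Real.exp (-(4 * Real.pi * r)) < 1 + 4 * Real.pi * u 0 ∧
      1 + 4 * Real.pi * u 0 < Real.exp (4 * Real.pi * r) := by
  have h := four_pi_pos
  change _ ∧ _ ↔ _
  rw [div_lt_iff₀ h, lt_div_iff₀ h]
  constructor <;> rintro ⟨h1, h2⟩ <;> constructor <;> linarith

lemma pos_of_mem_moduliBase {r : ℝ} {u : R3} (hu : u ∈ moduliBase r) :
    0 < 1 + 4 * Real.pi * u 0 :=
  (Real.exp_pos _).trans (mem_moduliBase_iff.1 hu).1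

/-- By `IsNormalizedTriple.integral_weight`, this identifies the total mass of the zeroth weight
with 1 + 4πu₀. -/
lemma exp_actionOf {u : R3} (hu : 0 < 1 + 4 * Real.pi * u 0) :
    Real.exp (-(4 * Real.pi * actionOf u 0)) = 1 + 4 * Real.pi * u 0 := by
  have h : -(4 * Real.pi * actionOf u 0) = Real.log (1 + 4 * Real.pi * u 0) := by
    simp [actionOf]
    field_simp
  rw [h, Real.exp_log hu]

lemma abs_actionOf_lt {r : ℝ} {u : R3} (hu : u ∈ moduliBase r) : |actionOf u 0| < r := by
  have h := exp_actionOf (pos_of_mem_moduliBase hu)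
  have h1 := mem_moduliBase_iff.1 hu
  rw [← h, Real.exp_lt_exp, Real.exp_lt_exp] at h1
  have := four_pi_pos
  rw [abs_lt]
  constructor <;> nlinarith [h1.1, h1.2]

lemma actionOf_affineOf (m : R3) : actionOf (affineOf m) = m := by
  have h := four_pi_pos.ne'
  ext k
  fin_cases k
  · have : 1 + 4 * Real.pi * ((Real.exp (-(4 * Real.pi * m 0)) - 1) / (4 * Real.pi)) =
        Real.exp (-(4 * Real.pi * m 0)) := by
      field_simp
      ring
    simp only [actionOf, affineOf, Fin.zero_eta, Matrix.cons_val_zero, this, Real.log_exp]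
    field_simp
  · simp [actionOf, affineOf]
  · simp [actionOf, affineOf]

lemma affineOf_actionOf {u : R3} (hu : 0 < 1 + 4 * Real.pi * u 0) :
    affineOf (actionOf u) = u := by
  ext k
  fin_cases k
  · simp only [affineOf, Fin.zero_eta, Matrix.cons_val_zero, exp_actionOf hu]
    field_simp
    ring
  · simp [actionOf, affineOf]
  · simp [actionOf, affineOf]

lemma affineOf_mem {r : ℝ} {m : R3} (hm : |m 0| < r) : affineOf m ∈ moduliBase r := by
  have h := four_pi_pos
  rw [abs_lt] at hm
  have h1 : Real.exp (-(4 * Real.pi * r)) < Real.exp (-(4 * Real.pi * m 0)) :=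
    Real.exp_lt_exp.2 (by nlinarith)
  have h2 : Real.exp (-(4 * Real.pi * m 0)) < Real.exp (4 * Real.pi * r) :=
    Real.exp_lt_exp.2 (by nlinarith)
  change (Real.exp (-(4 * Real.pi * m 0)) - 1) / (4 * Real.pi) ∈ Set.Ioo _ _
  exact ⟨div_lt_div_of_pos_right (by linarith) h, div_lt_div_of_pos_right (by linarith) h⟩

lemma zero_mem_moduliBase {r : ℝ} (hr : 0 < r) : (0 : R3) ∈ moduliBase r := by
  have h := affineOf_mem (r := r) (m := 0) (by simpa using hr)
  have h0 : affineOf 0 = 0 := by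
    ext k
    fin_cases k <;> simp [affineOf]
  rwa [h0] at h

lemma isOpen_moduliBase (r : ℝ) : IsOpen (moduliBase r) :=
  isOpen_Ioo.preimage (continuous_apply 0)

lemma convex_moduliBase (r : ℝ) : Convex ℝ (moduliBase r) :=
  (convex_Ioo _ _).is_linear_preimage
    (LinearMap.proj (R := ℝ) (φ := fun _ : Fin 3 => ℝ) 0).isLinear

lemma contDiffOn_actionOf (r : ℝ) : ContDiffOn ℝ (⊤ : ℕ∞) actionOf (moduliBase r) := by
  refine contDiffOn_pi.2 fun k => ?_
  fin_cases k
  · refine ContDiffOn.div_const (ContDiffOn.neg (ContDiffOn.log ?_ fun u hu =>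
      (pos_of_mem_moduliBase hu).ne')) _
    exact (contDiff_const.add (contDiff_const.mul (contDiff_apply ℝ ℝ 0))).contDiffOn
  · exact (contDiff_apply ℝ ℝ 1).neg.contDiffOn
  · exact (contDiff_apply ℝ ℝ 2).neg.contDiffOn

lemma hasFDerivAt_actionOf {u : R3} (hu : 0 < 1 + 4 * Real.pi * u 0) :
    ∃ D : R3 →L[ℝ] R3, HasFDerivAt actionOf D u ∧
      ∀ v, D v = ![-(v 0 / (1 + 4 * Real.pi * u 0)), -v 1, -v 2] := by
  let P : Fin 3 → R3 →L[ℝ] ℝ := ContinuousLinearMap.proj (R := ℝ) (φ := fun _ : Fin 3 => ℝ)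
  have hP : ∀ k, HasFDerivAt (fun v : R3 => v k) (P k) u := fun k => (P k).hasFDerivAt
  have h0 : HasFDerivAt (fun v : R3 => -Real.log (1 + 4 * Real.pi * v 0) / (4 * Real.pi))
      (-((1 + 4 * Real.pi * u 0)⁻¹ • P 0)) u := by
    have h1 := ((((hP 0).const_mul (4 * Real.pi)).const_add 1).log hu.ne').neg.mul_const
      ((4 * Real.pi)⁻¹)
    refine h1.congr_fderiv ?_
    ext v
    have := Real.pi_pos.ne'
    simp
    field_simp
  refine ⟨ContinuousLinearMap.pi ![-((1 + 4 * Real.pi * u 0)⁻¹ • P 0), -P 1, -P 2],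
    hasFDerivAt_pi.2 fun k => ?_, fun v => ?_⟩
  · fin_cases k
    · exact h0
    · exact (hP 1).neg
    · exact (hP 2).neg
  · ext k
    fin_cases k <;> simp [P]
    ring

namespace IsPotentialTriple

variable {r : ℝ} {f : Fin 3 → ℂ → ℂ}

lemma torus_slice (hf : IsPotentialTriple r f) (t : ℝ) : torus f ![t, 0, 0] = slice t := by
  ext x k
  fin_cases k
  · simp [torus, slice, hf.zero, mul_comm]
  · simp [torus, slice]
  · simp [torus, slice]

/-- A map which is `C¹`-close to the standard torus has nondegenerate Jacobian. -/
lemma det_jacobian_ne_zero (hr : 0 < r) (hf : IsPotentialTriple r f) {G : R3 → C3} {x : R3}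
    (hG : ‖fderiv ℝ G x - fderiv ℝ (slice 0) x‖ < 1 / 4) : (jacobian G x).det ≠ 0 := by
  have hm : |(0 : R3) 0| < r := by simpa using hr
  have hs : slice 0 = torus f 0 := by
    rw [← hf.torus_slice]
    congr 1
    ext k
    fin_cases k <;> rfl
  have h0 : ∀ i j, tangent (slice 0) i x j = if i = j then 1 else 0 := by
    intro i j
    have h := hf.coframe_tangent_torus hm x i j
    simp only [coframe, shear, hf.action_torus hm] at h
    rw [hs, ← h]
    simp
  have h1 : ∀ i j, ‖jacobian G x i j - if i = j then 1 else 0‖ < 1 / 4 := by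
    intro i j
    rw [← h0]
    have he : ‖e i‖ = 1 := by simp [e, Pi.norm_single]
    have h2 := (fderiv ℝ G x - fderiv ℝ (slice 0) x).le_opNorm (e i)
    rw [he, mul_one] at h2
    exact (norm_le_pi_norm ((fderiv ℝ G x - fderiv ℝ (slice 0) x) (e i)) j).trans_lt
      (h2.trans_lt hG)
  -- The Jacobian of the standard torus is the identity. With entries within 1/4 of it, the diagonal
  -- exceeds 3/4 while the off-diagonal sum of a row is at most 1/2.
  refine det_ne_zero_of_sum_row_lt_diag fun k => ?_
  have hoff : ∀ j ∈ Finset.univ.erase k, ‖jacobian G x k j‖ ≤ 1 / 4 := by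
    intro j hj
    have := h1 k j
    rw [if_neg (Finset.ne_of_mem_erase hj).symm, sub_zero] at this
    exact this.le
  have hdiag : 3 / 4 < ‖jacobian G x k k‖ := by
    have h3 := h1 k k
    rw [if_pos rfl] at h3
    have h4 := norm_sub_norm_le (1 : ℂ) (1 - jacobian G x k k)
    rw [sub_sub_cancel, norm_one, norm_sub_rev] at h4
    linarith
  have hsum := Finset.sum_le_card_nsmul _ _ _ hoff
  rw [Finset.card_erase_of_mem (Finset.mem_univ k), Finset.card_univ, Fintype.card_fin] at hsum
  have h5 : (3 - 1) • (1 / 4 : ℝ) = 1 / 2 := by norm_num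
  linarith

/-- The variational fields of the affine coordinates. -/
lemma ansatzForm_variation (hf : IsPotentialTriple r f) {u : R3} (hu : u ∈ moduliBase r)
    (k j : Fin 3) (x : R3) :
    ansatzForm f (torus f (actionOf u) x)
      ![fderiv ℝ (fun u' => torus f (actionOf u') x) u (e k), tangent (torus f (actionOf u)) j x] =
    if k = j then (if j = 0 then weight f (x 0 + Complex.I * actionOf u 0) 0 /
      (1 + 4 * Real.pi * u 0) else 1) else 0 := by
  have hm := abs_actionOf_lt hu
  obtain ⟨A, hA, hAv⟩ := hasFDerivAt_actionOf (pos_of_mem_moduliBase hu)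
  obtain ⟨D, hD, hDv⟩ := hf.exists_hasFDerivAt_torus hm x
  have hV : HasFDerivAt (fun u' => torus f (actionOf u') x)
      (D.comp (A.prod (0 : R3 →L[ℝ] R3))) u :=
    HasFDerivAt.comp (g := fun q : R3 × R3 => torus f q.1 q.2) u hD (hA.prodMk (hasFDerivAt_const x u))
  have hco : ∀ l, coframe f (torus f (actionOf u) x) l
      (fderiv ℝ (fun u' => torus f (actionOf u') x) u (e k)) =
      Complex.I * (A (e k) l * f l (x 0 + Complex.I * actionOf u 0)) := by
    intro l
    rw [hV.fderiv]
    simp only [ContinuousLinearMap.comp_apply, ContinuousLinearMap.prod_apply]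
    rw [hDv]
    simp
  have hre := hf.re_pos_torus hm x
  rw [ansatzForm_apply, Finset.sum_eq_single j]
  · rw [hco, hf.coframe_tangent_torus hm, if_pos rfl, hf.torus_zero]
    simp only [Complex.mul_im, Complex.mul_re, Complex.I_re, Complex.I_im, Complex.ofReal_re,
      Complex.ofReal_im, hAv]
    have h1 := (hre 1).ne'
    have h2 := (hre 2).ne'
    fin_cases k <;> fin_cases j <;> simp [e, weight, hf.zero]
    · ring
    · field_simp
    · field_simp
  · intro l _ hl
    rw [hco, hf.coframe_tangent_torus hm, if_neg hl.symm]
    simp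
  · simp

end IsPotentialTriple

namespace IsNormalizedTriple

variable {r : ℝ} {f : Fin 3 → ℂ → ℂ}

/-- The form ω(∂/∂m_k, ·) restricts to -w₀ da₀ for k = 0 and to -da_k otherwise, with periods
-e^{-4πm₀} and -1. Integrating from m = 0 gives u₀ = (e^{-4πm₀} - 1) / 4π and u_k = -m_k, which are
the formulas of `affineOf` and `actionOf`. Completeness is `exists_range_eq_range_torus`, its
nondegeneracy hypothesis being supplied by `det_jacobian_ne_zero`. -/
lemma isLocalModuli (hr : 0 < r) (hf : IsNormalizedTriple r f) :
    IsLocalModuli (strip r) (fun _ => stdVolumeForm) (ansatzForm f) (slice 0) (moduliBase r)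
      (fun u => torus f (actionOf u)) where
  isOpen := isOpen_moduliBase r
  convex := convex_moduliBase r
  zero_mem := zero_mem_moduliBase hr
  base := by
    rw [← hf.torus_slice]
    congr 1
    ext k
    fin_cases k <;> simp [actionOf]
  smooth := hf.contDiff_torus.comp_contDiffOn
    (((contDiffOn_actionOf r).comp contDiffOn_fst fun p hp => hp.1).prodMk contDiffOn_snd)
  slag _ hq := hf.isSLagTorus_torus (abs_actionOf_lt hq)
  affine u hu k j := by
    simp only [period, hf.ansatzForm_variation hu]
    by_cases hkj : k = j
    · by_cases hj : j = 0
      · subst hkj hj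
        have hpos := pos_of_mem_moduliBase hu
        simp only [if_true, e, Pi.smul_apply, Pi.single_eq_same, smul_eq_mul, mul_one]
        rw [intervalIntegral.integral_div, hf.integral_weight, exp_actionOf hpos,
          div_self hpos.ne']
      · simp [hkj, hj]
    · simp [hkj]
  injective u hu u' hu' h := by
    have := hf.eq_of_range_torus_eq (abs_actionOf_lt hu) (abs_actionOf_lt hu') h
    rw [← affineOf_actionOf (pos_of_mem_moduliBase hu), this,
      affineOf_actionOf (pos_of_mem_moduliBase hu')]
  complete := by
    refine ⟨1 / 4, by norm_num, fun G hG hclose => ?_⟩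
    obtain ⟨m, hm, hrange⟩ := hf.exists_range_eq_range_torus hG fun x =>
      hf.det_jacobian_ne_zero hr (hclose x).2
    exact ⟨affineOf m, affineOf_mem hm, by rw [hrange, actionOf_affineOf]⟩

end IsNormalizedTriple

/-! ### Harmonic forms -/

lemma pd_comp_zero {g : ℝ → ℝ} (hg : Differentiable ℝ g) {i : Fin 3} (hi : i ≠ 0) (x : R3) :
    pd i (fun y : R3 => g (y 0)) x = 0 := by
  have h := (hg (x 0)).hasDerivAt.comp_hasFDerivAt x
    (ContinuousLinearMap.proj (R := ℝ) (φ := fun _ : Fin 3 => ℝ) 0).hasFDerivAt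
  have h' : HasFDerivAt (fun y : R3 => g (y 0)) _ x := h
  rw [pd, h'.fderiv]
  simp [hi.symm]

@[simp] lemma pd_const {ι : Type} [DecidableEq ι] [Fintype ι] (i : ι) (c : ℝ) (x : ι → ℝ) :
    pd i (fun _ => c) x = 0 := by
  simp [pd]

open MeasureTheory in
/-- Integration over the unit cube of a function of the first coordinate. -/
lemma integral_cube_comp_zero (g : ℝ → ℝ) :
    ∫ x in Set.Icc (0 : R3) 1, g (x 0) = ∫ s in (0 : ℝ)..1, g s := by
  have h1 : Set.Icc (0 : R3) 1 = Set.univ.pi fun _ => Set.Icc (0 : ℝ) 1 := by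
    ext x
    simp [Pi.le_def]
  have h2 : (volume : Measure R3).restrict (Set.Icc 0 1) =
      Measure.pi fun _ : Fin 3 => (volume : Measure ℝ).restrict (Set.Icc 0 1) := by
    rw [h1, volume_pi, Measure.restrict_pi_pi]
  have h3 := integral_fin_nat_prod_eq_prod (𝕜 := ℝ)
    (μ := fun _ : Fin 3 => (volume : Measure ℝ).restrict (Set.Icc 0 1))
    (fun i : Fin 3 => if i = 0 then g else fun _ => 1)
  rw [h2]
  simp only [Fin.prod_univ_three] at h3
  simp at h3
  rw [h3, intervalIntegral.integral_of_le zero_le_one, integral_Icc_eq_integral_Ioc]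

/-- The harmonic forms on the torus with parameter `u` dual to the standard homology basis. -/
def harmonicBasis (f : Fin 3 → ℂ → ℂ) (u : R3) (j : Fin 3) (x : R3) : R3 :=
  Pi.single j (if j = 0 then weight f (x 0 + Complex.I * actionOf u 0) 0 /
    (1 + 4 * Real.pi * u 0) else 1)

/-- The `L²` metric on the moduli space in affine coordinates. -/
def moduliMetric (u : R3) : Matrix (Fin 3) (Fin 3) ℝ :=
  Matrix.diagonal ![(1 + 4 * Real.pi * u 0)⁻¹, 1, 1]

lemma inv_diagonal_of_ne_zero {ι : Type} [Fintype ι] [DecidableEq ι] {d : ι → ℝ}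
    (h : ∀ k, d k ≠ 0) : (Matrix.diagonal d)⁻¹ = Matrix.diagonal fun k => (d k)⁻¹ := by
  refine Matrix.inv_eq_right_inv ?_
  rw [Matrix.diagonal_mul_diagonal, ← Matrix.diagonal_one]
  congr 1
  ext k
  exact mul_inv_cancel₀ (h k)

namespace IsPotentialTriple

variable {r : ℝ} {f : Fin 3 → ℂ → ℂ}

lemma differentiable_re_line (hf : IsPotentialTriple r f) (k : Fin 3) (t : ℝ) :
    ContDiff ℝ (⊤ : ℕ∞) (fun s : ℝ => (f k (s + Complex.I * t)).re) :=
  Complex.reCLM.contDiff.comp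
    ((hf.contDiff_real k).comp (Complex.ofRealCLM.contDiff.add contDiff_const))

lemma contDiff_weight_line (hf : IsPotentialTriple r f) (t : ℝ) :
    ContDiff ℝ (⊤ : ℕ∞) (fun s : ℝ => weight f (s + Complex.I * t) 0) :=
  (hf.differentiable_re_line 1 t).mul (hf.differentiable_re_line 2 t)

lemma weight_ne_zero (hf : IsPotentialTriple r f) {t : ℝ} (ht : |t| < r) (s : ℝ) (k : Fin 3) :
    weight f (s + Complex.I * t) k ≠ 0 :=
  (hf.weight_pos (by simpa using ht) k).ne'

/-- In a diagonal metric the coclosedness equation of `harmonicBasis` only involves functions of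
the first coordinate. -/
lemma isHarmonicForm_harmonicBasis (hf : IsPotentialTriple r f) {u : R3} (hu : u ∈ moduliBase r)
    (j : Fin 3) : IsHarmonicForm (inducedMetric (ansatzForm f) (torus f (actionOf u)))
      (harmonicBasis f u j) where
  smooth := by
    refine contDiff_pi.2 fun i => ?_
    by_cases hi : i = j
    · subst hi
      simp only [harmonicBasis, Pi.single_eq_same]
      split_ifs
      · exact ((hf.contDiff_weight_line (actionOf u 0)).div_const _).comp (contDiff_apply ℝ ℝ 0)
      · exact contDiff_const
    · simp only [harmonicBasis, Pi.single_eq_of_ne hi]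
      exact contDiff_const
  periodic x n := by
    have h : (((x + intVec n) 0 : ℝ) : ℂ) + Complex.I * actionOf u 0 =
        (x 0 + Complex.I * actionOf u 0) + n 0 := by
      simp [intVec]
      ring
    simp only [harmonicBasis, h, weight, hf.periodic_int]
  closed x i l := by
    have h : ∀ a b : Fin 3, a ≠ b → pd a (fun y => harmonicBasis f u j y b) x = 0 := by
      intro a b hab
      by_cases hb : b = j
      · subst hb
        simp only [harmonicBasis, Pi.single_eq_same]
        split_ifs with hb0
        · exact pd_comp_zero (((hf.contDiff_weight_line (actionOf u 0)).div_const _).differentiable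
            (by simp)) (hb0 ▸ hab) x
        · exact pd_const _ _ _
      · simp only [harmonicBasis, Pi.single_eq_of_ne hb, pd_const]
    by_cases hil : i = l
    · rw [hil]
    · rw [h i l hil, h l i (Ne.symm hil)]
  coclosed x := by
    have hm := abs_actionOf_lt hu
    have hW := hf.weight_ne_zero hm
    refine Finset.sum_eq_zero fun i _ => ?_
    have h : (fun y => √(inducedMetric (ansatzForm f) (torus f (actionOf u)) y).det *
        ∑ l, (inducedMetric (ansatzForm f) (torus f (actionOf u)) y)⁻¹ i l *
          harmonicBasis f u j y l) =
        fun y : R3 => (weight f (y 0 + Complex.I * actionOf u 0) i)⁻¹ * harmonicBasis f u j y i := by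
      ext y
      rw [hf.det_inducedMetric_torus hm, hf.inducedMetric_torus hm,
        inv_diagonal_of_ne_zero (hW (y 0))]
      simp [Matrix.diagonal_apply]
    rw [h]
    by_cases hij : i = j
    · subst hij
      simp only [harmonicBasis, Pi.single_eq_same]
      split_ifs with hi
      · subst hi
        -- The factor w₀ in the form cancels the inverse metric coefficient, so the flux is
        -- constant.
        have h2 : ∀ y : R3, (weight f (y 0 + Complex.I * actionOf u 0) 0)⁻¹ *
            (weight f (y 0 + Complex.I * actionOf u 0) 0 / (1 + 4 * Real.pi * u 0)) =
            (1 + 4 * Real.pi * u 0)⁻¹ := by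
          intro y
          have := hW (y 0) 0
          field_simp
        simp only [h2, pd_const]
      -- The flux is Re f_i, a function of the zeroth coordinate, differentiated in direction i ≠ 0.
      · simp only [weight_of_ne i hi, inv_inv, mul_one]
        exact pd_comp_zero ((hf.differentiable_re_line i (actionOf u 0)).differentiable
          (by simp)) hi x
    · simp only [harmonicBasis, Pi.single_eq_of_ne hij, mul_zero, pd_const]

end IsPotentialTriple

namespace IsNormalizedTriple

variable {r : ℝ} {f : Fin 3 → ℂ → ℂ}

lemma isDualHarmonicBasis (hf : IsNormalizedTriple r f) {u : R3} (hu : u ∈ moduliBase r) :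
    IsDualHarmonicBasis (inducedMetric (ansatzForm f) (torus f (actionOf u)))
      (harmonicBasis f u) where
  harmonic := hf.isHarmonicForm_harmonicBasis hu
  dual i j := by
    by_cases hij : i = j
    · subst hij
      by_cases hi : i = 0
      · subst hi
        have hpos := pos_of_mem_moduliBase hu
        simp only [period, harmonicBasis, if_true, e, Pi.smul_apply, Pi.single_eq_same,
          smul_eq_mul, mul_one]
        rw [intervalIntegral.integral_div, hf.integral_weight, exp_actionOf hpos,
          div_self hpos.ne']
      · simp [period, harmonicBasis, hi]
    · simp [period, harmonicBasis, hij]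

/-- The volume density is 1, so the zeroth diagonal entry is ∫ w₀⁻¹ (w₀ / W)² = 1 / W with W = ∫ w₀
= 1 + 4πu₀, and the others are ∫ Re f_i = 1. Distinct basis forms are pointwise orthogonal. -/
lemma l2Gram_harmonicBasis (hf : IsNormalizedTriple r f) {u : R3} (hu : u ∈ moduliBase r) :
    l2Gram (inducedMetric (ansatzForm f) (torus f (actionOf u))) (harmonicBasis f u) =
      moduliMetric u := by
  have hm := abs_actionOf_lt hu
  have hpos := pos_of_mem_moduliBase hu
  have hW := hf.weight_ne_zero hm
  ext i j
  have h : l2Gram (inducedMetric (ansatzForm f) (torus f (actionOf u))) (harmonicBasis f u) i j =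
      ∫ x in Set.Icc (0 : R3) 1, (∑ a, (weight f (x 0 + Complex.I * actionOf u 0) a)⁻¹ *
        harmonicBasis f u i x a * harmonicBasis f u j x a) := by
    rw [l2Gram, Matrix.of_apply, l2Inner]
    congr 1
    ext x
    rw [hf.det_inducedMetric_torus hm, hf.inducedMetric_torus hm,
      inv_diagonal_of_ne_zero (hW (x 0))]
    simp [Matrix.diagonal_apply]
  rw [h]
  by_cases hij : i = j
  · subst hij
    have h1 : ∀ x : R3, (∑ a, (weight f (x 0 + Complex.I * actionOf u 0) a)⁻¹ *
        harmonicBasis f u i x a * harmonicBasis f u i x a) =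
        (weight f (x 0 + Complex.I * actionOf u 0) i)⁻¹ * harmonicBasis f u i x i *
          harmonicBasis f u i x i := fun x =>
      Finset.sum_eq_single i (fun a _ ha => by simp [harmonicBasis, ha]) (by simp)
    simp only [h1]
    simp only [harmonicBasis, Pi.single_eq_same]
    by_cases hi : i = 0
    · subst hi
      have h2 : ∀ x : R3, (weight f (x 0 + Complex.I * actionOf u 0) 0)⁻¹ *
          (weight f (x 0 + Complex.I * actionOf u 0) 0 / (1 + 4 * Real.pi * u 0)) *
          (weight f (x 0 + Complex.I * actionOf u 0) 0 / (1 + 4 * Real.pi * u 0)) =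
          weight f (x 0 + Complex.I * actionOf u 0) 0 / (1 + 4 * Real.pi * u 0) ^ 2 := by
        intro x
        have := hW (x 0) 0
        field_simp
      simp only [if_true, h2]
      rw [integral_cube_comp_zero fun s => weight f (s + Complex.I * actionOf u 0) 0 /
        (1 + 4 * Real.pi * u 0) ^ 2, intervalIntegral.integral_div, hf.integral_weight,
        exp_actionOf hpos]
      simp [moduliMetric]
      field_simp
    · simp only [if_neg hi, IsPotentialTriple.weight_of_ne i hi, inv_inv, mul_one]
      rw [integral_cube_comp_zero fun s => (f i (s + Complex.I * actionOf u 0)).re,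
        hf.integral_re]
      fin_cases i
      · exact absurd rfl hi
      · simp [moduliMetric]
      · simp [moduliMetric]
  · have h1 : ∀ x : R3, (∑ a, (weight f (x 0 + Complex.I * actionOf u 0) a)⁻¹ *
        harmonicBasis f u i x a * harmonicBasis f u j x a) = 0 := by
      intro x
      refine Finset.sum_eq_zero fun a _ => ?_
      by_cases ha : a = i
      · have : a ≠ j := fun h => hij (ha.symm.trans h)
        simp [harmonicBasis, this]
      · simp [harmonicBasis, ha]
    simp [h1, moduliMetric, hij]

end IsNormalizedTriple

/-! ### Explicit potentials -/

/-- The potentials `1`, `1 + e^{2πiz} / 2`, `1 + 4 e^{2πiz} - 4 e^{-2πiz}`. -/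
def potential : Fin 3 → ℂ → ℂ :=
  ![fun _ => 1, fun z => 1 + 1 / 2 * Complex.exp (2 * Real.pi * Complex.I * z),
    fun z => 1 + 4 * Complex.exp (2 * Real.pi * Complex.I * z) -
      4 * Complex.exp (-(2 * Real.pi * Complex.I * z))]

lemma exp_re (s t : ℝ) : (Complex.exp (2 * Real.pi * Complex.I * (s + Complex.I * t))).re =
    Real.exp (-(2 * Real.pi * t)) * Real.cos (2 * Real.pi * s) := by
  simp [Complex.exp_re]

lemma exp_neg_re (s t : ℝ) :
    (Complex.exp (-(2 * Real.pi * Complex.I * (s + Complex.I * t)))).re =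
    Real.exp (2 * Real.pi * t) * Real.cos (2 * Real.pi * s) := by
  simp [Complex.exp_re]

lemma potential_one_re (s t : ℝ) : (potential 1 (s + Complex.I * t)).re =
    1 + 1 / 2 * Real.exp (-(2 * Real.pi * t)) * Real.cos (2 * Real.pi * s) := by
  have h : (1 / 2 : ℂ) = ((1 / 2 : ℝ) : ℂ) := by norm_num
  simp only [potential, Matrix.cons_val, Complex.add_re, Complex.one_re, h, Complex.re_ofReal_mul,
    exp_re]
  ring

lemma potential_two_re (s t : ℝ) : (potential 2 (s + Complex.I * t)).re =
    1 + 4 * (Real.exp (-(2 * Real.pi * t)) - Real.exp (2 * Real.pi * t)) *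
      Real.cos (2 * Real.pi * s) := by
  have h : (4 : ℂ) = ((4 : ℝ) : ℂ) := by norm_num
  simp only [potential, Matrix.cons_val, Complex.add_re, Complex.sub_re, Complex.one_re, h,
    Complex.re_ofReal_mul, exp_re, exp_neg_re]
  ring

/-- Apply 1 + y ≤ e^y at x and -x, and use e^x e^{-x} = 1. The range covers 2πt for |t| < 1/100, and
the bounds keep the cosine coefficients in `potential_one_re` and `potential_two_re` below 1 in
absolute value. -/
lemma exp_bounds {x : ℝ} (hx : |x| < 7 / 100) : 93 / 100 < Real.exp x ∧ Real.exp x < 11 / 10 := by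
  rw [abs_lt] at hx
  have h1 := Real.add_one_le_exp x
  have h2 := Real.add_one_le_exp (-x)
  have h3 : Real.exp x * Real.exp (-x) = 1 := by rw [← Real.exp_add]; simp
  have h4 := Real.exp_pos x
  constructor
  · linarith
  · nlinarith

lemma isPotentialTriple_potential : IsPotentialTriple (1 / 100) potential where
  zero _ := rfl
  differentiable k := by
    fin_cases k <;> simp only [potential] <;> simp <;> fun_prop
  periodic k z := by
    have h1 : Complex.exp (2 * Real.pi * Complex.I * (z + 1)) =
        Complex.exp (2 * Real.pi * Complex.I * z) := by
      rw [mul_add, mul_one, Complex.exp_add, Complex.exp_two_pi_mul_I, mul_one]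
    have h2 : Complex.exp (-(2 * Real.pi * Complex.I * (z + 1))) =
        Complex.exp (-(2 * Real.pi * Complex.I * z)) := by
      rw [Complex.exp_neg, Complex.exp_neg, h1]
    fin_cases k <;> simp [potential, h1, h2]
  pos k z hz := by
    obtain ⟨s, t, rfl⟩ : ∃ s t : ℝ, z = s + Complex.I * t := ⟨z.re, z.im, by
      rw [mul_comm]
      exact (Complex.re_add_im z).symm⟩
    have ht : |t| < 1 / 100 := by simpa using hz
    have hpi := Real.pi_lt_d2
    have hpi0 := Real.pi_pos
    have hx : |2 * Real.pi * t| < 7 / 100 := by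
      rw [abs_mul, abs_of_pos (by positivity)]
      nlinarith [abs_nonneg t]
    obtain ⟨h1, h2⟩ := exp_bounds hx
    obtain ⟨h3, h4⟩ := exp_bounds (x := -(2 * Real.pi * t)) (by rwa [abs_neg])
    have hc : |Real.cos (2 * Real.pi * s)| ≤ 1 := Real.abs_cos_le_one _
    have hbound : ∀ a : ℝ, |a| < 1 → 0 < 1 + a * Real.cos (2 * Real.pi * s) := by
      intro a ha
      have h5 : |a * Real.cos (2 * Real.pi * s)| < 1 := by
        rw [abs_mul]
        nlinarith [abs_nonneg a, abs_nonneg (Real.cos (2 * Real.pi * s))]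
      linarith [(abs_lt.1 h5).1]
    fin_cases k
    · simp [potential]
    · change 0 < (potential 1 _).re
      rw [potential_one_re]
      refine hbound _ ?_
      rw [abs_lt]
      constructor <;> linarith
    · change 0 < (potential 2 _).re
      rw [potential_two_re]
      refine hbound _ ?_
      rw [abs_lt]
      constructor <;> linarith

lemma integral_cos_two_pi : ∫ s in (0 : ℝ)..1, Real.cos (2 * Real.pi * s) = 0 := by
  rw [intervalIntegral.integral_comp_mul_left _ (by positivity), integral_cos]
  simp

lemma integral_cos_sq_two_pi : ∫ s in (0 : ℝ)..1, Real.cos (2 * Real.pi * s) ^ 2 = 1 / 2 := by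
  rw [intervalIntegral.integral_comp_mul_left (fun s => Real.cos s ^ 2) (by positivity),
    integral_cos_sq]
  have := Real.pi_pos.ne'
  simp
  field_simp

lemma integral_affine_cos (a b c : ℝ) :
    ∫ s in (0 : ℝ)..1, (a + b * Real.cos (2 * Real.pi * s) + c * Real.cos (2 * Real.pi * s) ^ 2) =
      a + c / 2 := by
  have h1 : IntervalIntegrable (fun s => b * Real.cos (2 * Real.pi * s)) MeasureTheory.volume 0 1 :=
    (by fun_prop : Continuous fun s => b * Real.cos (2 * Real.pi * s)).intervalIntegrable _ _
  have h2 : IntervalIntegrable (fun s => c * Real.cos (2 * Real.pi * s) ^ 2)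
      MeasureTheory.volume 0 1 :=
    (by fun_prop : Continuous fun s => c * Real.cos (2 * Real.pi * s) ^ 2).intervalIntegrable _ _
  have h0 : IntervalIntegrable (fun _ : ℝ => a) MeasureTheory.volume 0 1 :=
    intervalIntegrable_const
  rw [intervalIntegral.integral_add (h0.add h1) h2, intervalIntegral.integral_add h0 h1,
    intervalIntegral.integral_const_mul, intervalIntegral.integral_const_mul,
    integral_cos_two_pi, integral_cos_sq_two_pi]
  simp
  ring

/-- With q = e^{-2πt}, the real parts are 1 + (q/2) cos and 1 + 4(q - 1/q) cos. Each has mean 1, and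
their product has mean 1 + (1/2)(q/2) · 4(q - 1/q) = q². The coefficients 1/2 and 4 are matched so
that the constant cancels and a pure exponential e^{-4πt} remains. -/
lemma isNormalizedTriple_potential : IsNormalizedTriple (1 / 100) potential where
  toIsPotentialTriple := isPotentialTriple_potential
  integral_weight t := by
    have h1 : Real.exp (-(2 * Real.pi * t)) * Real.exp (2 * Real.pi * t) = 1 := by
      rw [← Real.exp_add]
      simp
    have h2 : Real.exp (-(2 * Real.pi * t)) * Real.exp (-(2 * Real.pi * t)) =
        Real.exp (-(4 * Real.pi * t)) := by
      rw [← Real.exp_add]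
      congr 1
      ring
    have h3 : ∀ s : ℝ, weight potential (s + Complex.I * t) 0 =
        1 + (1 / 2 * Real.exp (-(2 * Real.pi * t)) +
          4 * (Real.exp (-(2 * Real.pi * t)) - Real.exp (2 * Real.pi * t))) *
            Real.cos (2 * Real.pi * s) +
          (2 * (Real.exp (-(4 * Real.pi * t)) - 1)) * Real.cos (2 * Real.pi * s) ^ 2 := by
      intro s
      simp only [weight, Matrix.cons_val_zero, potential_one_re, potential_two_re]
      linear_combination (2 * Real.cos (2 * Real.pi * s) ^ 2) * (h2 - h1)
    simp only [h3, integral_affine_cos]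
    ring
  integral_re k t := by
    fin_cases k
    · simp [potential]
    · have h := integral_affine_cos 1 (1 / 2 * Real.exp (-(2 * Real.pi * t))) 0
      simp only [zero_mul, add_zero, zero_div, ← potential_one_re] at h
      exact h
    · have h := integral_affine_cos 1
        (4 * (Real.exp (-(2 * Real.pi * t)) - Real.exp (2 * Real.pi * t))) 0
      simp only [zero_mul, add_zero, zero_div, ← potential_two_re] at h
      exact h

lemma analyticAt_potential_re (k : Fin 3) (p : ℝ × ℝ) :
    AnalyticAt ℝ (fun q : ℝ × ℝ => (potential k (q.1 + Complex.I * q.2)).re) p := by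
  have hx : AnalyticAt ℝ (fun q : ℝ × ℝ => Real.cos (2 * Real.pi * q.1)) p :=
    Real.analyticAt_cos.comp (analyticAt_const.mul analyticAt_fst)
  have hy : AnalyticAt ℝ (fun q : ℝ × ℝ => Real.exp (2 * Real.pi * q.2)) p :=
    analyticAt_rexp.comp (analyticAt_const.mul analyticAt_snd)
  have hy' : AnalyticAt ℝ (fun q : ℝ × ℝ => Real.exp (-(2 * Real.pi * q.2))) p :=
    analyticAt_rexp.comp (analyticAt_const.mul analyticAt_snd).neg
  fin_cases k
  · simpa [potential] using analyticAt_const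
  · change AnalyticAt ℝ (fun q : ℝ × ℝ => (potential 1 _).re) p
    simp only [potential_one_re]
    exact analyticAt_const.add ((analyticAt_const.mul hy').mul hx)
  · change AnalyticAt ℝ (fun q : ℝ × ℝ => (potential 2 _).re) p
    simp only [potential_two_re]
    exact analyticAt_const.add ((analyticAt_const.mul (hy'.sub hy)).mul hx)

lemma analyticAt_weight_potential (k : Fin 3) {p : ℝ × ℝ} (hp : |p.2| < 1 / 100) :
    AnalyticAt ℝ (fun q : ℝ × ℝ => weight potential (q.1 + Complex.I * q.2) k) p := by
  have hne : ∀ k, (potential k (p.1 + Complex.I * p.2)).re ≠ 0 := fun k =>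
    (isPotentialTriple_potential.pos k _ (by simpa using hp)).ne'
  fin_cases k
  · exact (analyticAt_potential_re 1 p).mul (analyticAt_potential_re 2 p)
  · exact (analyticAt_potential_re 1 p).inv (hne 1)
  · exact (analyticAt_potential_re 2 p).inv (hne 2)

/-! ### The mirror -/

lemma semiFlatForm_moduliMetric (w : C3) : semiFlatForm moduliMetric w =
    ∑ k, (![(1 + 4 * Real.pi * (w 0).re)⁻¹, 1, 1] : Fin 3 → ℝ) k • wedgeTwo (dRe k) (dIm k) := by
  rw [semiFlatForm]
  refine Finset.sum_congr rfl fun i _ => ?_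
  rw [Finset.sum_eq_single i]
  · simp [moduliMetric]
  · intro j _ hj
    simp [moduliMetric, hj.symm]
  · simp

lemma isOpen_tube_moduliBase (r : ℝ) : IsOpen (tube (moduliBase r)) :=
  (isOpen_moduliBase r).preimage (f := fun (w : C3) j => (w j).re) (by fun_prop)

lemma semiFlatForm_moduliMetric_apply (w v v' : C3) : semiFlatForm moduliMetric w ![v, v'] =
    ∑ k, (![(1 + 4 * Real.pi * (w 0).re)⁻¹, 1, 1] : Fin 3 → ℝ) k *
      ((v k).re * (v' k).im - (v' k).re * (v k).im) := by
  rw [semiFlatForm_moduliMetric]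
  simp [Fin.sum_univ_three]

lemma kahlerMetric_semiFlatForm (w v v' : C3) : kahlerMetric (semiFlatForm moduliMetric w) v v' =
    ∑ k, (![(1 + 4 * Real.pi * (w 0).re)⁻¹, 1, 1] : Fin 3 → ℝ) k *
      ((v k).re * (v' k).re + (v k).im * (v' k).im) := by
  rw [kahlerMetric, semiFlatForm_moduliMetric_apply]
  refine Finset.sum_congr rfl fun k _ => ?_
  simp
  ring_nf
  simp

lemma isKahlerForm_semiFlatForm (r : ℝ) :
    IsKahlerForm (tube (moduliBase r)) (semiFlatForm moduliMetric) where
  isOpen := isOpen_tube_moduliBase r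
  smooth := by
    rw [show semiFlatForm moduliMetric = _ from funext semiFlatForm_moduliMetric]
    refine ContDiffOn.sum fun k _ => ?_
    have h : ContDiffOn ℝ (⊤ : ℕ∞) (fun w : C3 =>
        (![(1 + 4 * Real.pi * (w 0).re)⁻¹, 1, 1] : Fin 3 → ℝ) k) (tube (moduliBase r)) := by
      fin_cases k
      · refine ContDiffOn.inv ?_ fun w hw =>
          (pos_of_mem_moduliBase (u := fun j => (w j).re) hw).ne'
        exact (contDiff_const.add (contDiff_const.mul (dRe 0).contDiff)).contDiffOn
      · exact contDiffOn_const
      · exact contDiffOn_const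
    exact h.smul contDiffOn_const
  closed w hw := by
    have hpos : 0 < 1 + 4 * Real.pi * (w 0).re :=
      pos_of_mem_moduliBase (u := fun j => (w j).re) hw
    have h0 : HasFDerivAt (fun v : C3 => (1 + 4 * Real.pi * (v 0).re)⁻¹)
        ((-(4 * Real.pi) * ((1 + 4 * Real.pi * (w 0).re) ^ 2)⁻¹) • dRe 0 + (0 : ℝ) • dIm 0) w := by
      have h1 := (hasDerivAt_inv hpos.ne').comp_hasFDerivAt w
        ((((dRe 0).hasFDerivAt (x := w)).const_mul (4 * Real.pi)).const_add 1)
      refine h1.congr_fderiv ?_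
      ext v
      simp
      ring
    have h1 : ∀ k, HasFDerivAt (fun _ : C3 => (1 : ℝ)) ((0 : ℝ) • dRe k + (0 : ℝ) • dIm k) w := by
      intro k
      simpa using hasFDerivAt_const (1 : ℝ) w
    obtain ⟨d0, e0⟩ := extDeriv_smul_wedgeTwo h0
    obtain ⟨d1, e1⟩ := extDeriv_smul_wedgeTwo (h1 1)
    obtain ⟨d2, e2⟩ := extDeriv_smul_wedgeTwo (h1 2)
    rw [show semiFlatForm moduliMetric = _ from funext semiFlatForm_moduliMetric]
    simp only [Fin.sum_univ_three, Matrix.cons_val]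
    refine (extDeriv_fun_add (d0.add d1) d2).trans ?_
    rw [extDeriv_add d0 d1, e0, e1, e2]
    simp
  type_one_one w _ v v' := by
    rw [semiFlatForm_moduliMetric_apply, semiFlatForm_moduliMetric_apply]
    refine Finset.sum_congr rfl fun k _ => ?_
    simp
    ring_nf
    simp
  positive w hw v hv := by
    have hpos : 0 < 1 + 4 * Real.pi * (w 0).re :=
      pos_of_mem_moduliBase (u := fun j => (w j).re) hw
    rw [kahlerMetric_semiFlatForm]
    have hd : ∀ k, 0 < (![(1 + 4 * Real.pi * (w 0).re)⁻¹, 1, 1] : Fin 3 → ℝ) k := by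
      intro k
      fin_cases k <;> (simp; try exact hpos)
    have hnn : ∀ k, 0 ≤ (![(1 + 4 * Real.pi * (w 0).re)⁻¹, 1, 1] : Fin 3 → ℝ) k *
        ((v k).re * (v k).re + (v k).im * (v k).im) := fun k =>
      mul_nonneg (hd k).le (add_nonneg (mul_self_nonneg _) (mul_self_nonneg _))
    refine lt_of_le_of_ne (Finset.sum_nonneg fun k _ => hnn k) fun h0 => hv ?_
    ext k
    have := (Finset.sum_eq_zero_iff_of_nonneg fun k _ => hnn k).1 h0.symm k (Finset.mem_univ k)
    exact Complex.normSq_eq_zero.1 ((mul_eq_zero.1 this).resolve_left (hd k).ne')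

/-- The relation would force the product of the weights, which is 1 / (1 + 4πu₀), to be constant. It
is compared at the origin and at the point with action coordinate r/2, where it equals e^{2πr}. -/
lemma not_calabiYauRelation_semiFlatForm {r : ℝ} (hr : 0 < r) :
    ¬ CalabiYauRelation (tube (moduliBase r)) (fun _ => stdVolumeForm)
      (semiFlatForm moduliMetric) := by
  intro h
  let m : R3 := ![r / 2, 0, 0]
  have hm : |m 0| < r := by
    simp only [m, Matrix.cons_val_zero]
    rw [abs_of_pos (by positivity)]
    linarith
  let q : C3 := fun k => (affineOf m k : ℂ)
  have hq : q ∈ tube (moduliBase r) := affineOf_mem hm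
  have h0 : (0 : C3) ∈ tube (moduliBase r) := zero_mem_moduliBase hr
  have h1 := h.weight_prod_eq (fun w _ => semiFlatForm_moduliMetric w) h0 hq
  have h2 : 1 + 4 * Real.pi * affineOf m 0 = Real.exp (-(4 * Real.pi * (r / 2))) := by
    simp [affineOf, m]
    field_simp
    ring
  simp only [Matrix.cons_val, mul_one, q, Complex.ofReal_re, h2] at h1
  simp at h1
  exact hr.ne' h1

/-! ### Ricci curvature of the mirror -/

/-- The indicator of the plane on which the semi-flat metric is not flat. -/
def planeIndicator (a : Fin 3 ⊕ Fin 3) : ℤ :=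
  if a = Sum.inl 0 ∨ a = Sum.inr 0 then 1 else 0

/-- The Christoffel symbols of a conformally flat metric on a plane in units of half the logarithmic
derivative of the conformal factor, which depends on the first coordinate. -/
def christoffelCoeff (k i j : Fin 3 ⊕ Fin 3) : ℤ :=
  planeIndicator k * ((if j = k ∧ i = Sum.inl 0 then 1 else 0) +
    (if i = k ∧ j = Sum.inl 0 then 1 else 0)) -
  planeIndicator i * (if i = j ∧ k = Sum.inl 0 then 1 else 0)

lemma metricMatrix_semiFlatForm (y : Fin 3 ⊕ Fin 3 → ℝ) :
    metricMatrix (semiFlatForm moduliMetric) y = Matrix.diagonal fun a =>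
      1 + planeIndicator a * ((1 + 4 * Real.pi * y (Sum.inl 0))⁻¹ - 1) := by
  ext a b
  rw [metricMatrix, Matrix.of_apply, kahlerMetric_semiFlatForm]
  rcases a with a | a <;> rcases b with b | b <;> fin_cases a <;> fin_cases b <;>
    simp [Fin.sum_univ_three, coordVec, toC3, planeIndicator]

lemma pd_metricMatrix {y : Fin 3 ⊕ Fin 3 → ℝ} (hy : 1 + 4 * Real.pi * y (Sum.inl 0) ≠ 0)
    (l i j : Fin 3 ⊕ Fin 3) :
    pd l (fun z => metricMatrix (semiFlatForm moduliMetric) z i j) y =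
      planeIndicator i * (if i = j ∧ l = Sum.inl 0 then 1 else 0) *
        (-(4 * Real.pi) * ((1 + 4 * Real.pi * y (Sum.inl 0)) ^ 2)⁻¹) := by
  simp only [metricMatrix_semiFlatForm]
  by_cases hij : i = j
  · subst hij
    simp only [Matrix.diagonal_apply_eq, true_and]
    have h1 := (hasDerivAt_inv hy).comp_hasFDerivAt y
      (((ContinuousLinearMap.proj (R := ℝ) (φ := fun _ : Fin 3 ⊕ Fin 3 => ℝ)
        (Sum.inl 0)).hasFDerivAt.const_mul (4 * Real.pi)).const_add 1)
    have h2 : HasFDerivAt (fun z : Fin 3 ⊕ Fin 3 → ℝ =>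
      1 + (planeIndicator i : ℝ) * ((1 + 4 * Real.pi * z (Sum.inl 0))⁻¹ - 1)) _ y :=
      ((h1.sub_const 1).const_mul (planeIndicator i : ℝ)).const_add 1
    rw [pd, h2.fderiv]
    by_cases hl : l = Sum.inl 0
    · subst hl
      simp only [smul_apply, ContinuousLinearMap.proj_apply,
        Pi.single_eq_same, smul_eq_mul, if_true]
      ring
    · simp [hl, Ne.symm hl]
  · simp [hij]

lemma christoffel_semiFlatForm {y : Fin 3 ⊕ Fin 3 → ℝ} (hy : 0 < 1 + 4 * Real.pi * y (Sum.inl 0))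
    (k i j : Fin 3 ⊕ Fin 3) :
    christoffel (metricMatrix (semiFlatForm moduliMetric)) k i j y =
      christoffelCoeff k i j * (-(2 * Real.pi) * (1 + 4 * Real.pi * y (Sum.inl 0))⁻¹) := by
  have hne : ∀ a, 1 + (planeIndicator a : ℝ) * ((1 + 4 * Real.pi * y (Sum.inl 0))⁻¹ - 1) ≠ 0 := by
    intro a
    by_cases ha : a = Sum.inl 0 ∨ a = Sum.inr 0
    · simp [planeIndicator, ha, hy.ne']
    · simp [planeIndicator, ha]
  rw [christoffel, metricMatrix_semiFlatForm, inv_diagonal_of_ne_zero hne,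
    Finset.sum_eq_single k]
  · simp only [pd_metricMatrix hy.ne', Matrix.diagonal_apply_eq, christoffelCoeff]
    -- If k lies off the plane, all terms vanish; if it lies in it, the metric coefficient is 1 / (1
    -- + 4πu₀), whose half logarithmic derivative is -2π / (1 + 4πu₀).
    have hpk : (planeIndicator k : ℝ) = 0 ∨ (planeIndicator k : ℝ) = 1 := by
      rw [planeIndicator]
      split_ifs <;> simp
    have h1 : (planeIndicator j : ℝ) * (if j = k ∧ i = Sum.inl 0 then 1 else 0) =
        planeIndicator k * (if j = k ∧ i = Sum.inl 0 then 1 else 0) := by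
      by_cases hjk : j = k
      · rw [hjk]
      · simp [hjk]
    have h2 : (planeIndicator i : ℝ) * (if i = k ∧ j = Sum.inl 0 then 1 else 0) =
        planeIndicator k * (if i = k ∧ j = Sum.inl 0 then 1 else 0) := by
      by_cases hik : i = k
      · rw [hik]
      · simp [hik]
    have h3 : (planeIndicator i : ℝ) * (if i = j ∧ k = Sum.inl 0 then 1 else 0) =
        planeIndicator k * (planeIndicator i * (if i = j ∧ k = Sum.inl 0 then 1 else 0)) := by
      by_cases hk : k = Sum.inl 0
      · simp [hk, planeIndicator]
      · simp [hk]
    have hy' := hy.ne'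
    rw [h1, h2]
    push_cast
    rcases hpk with hpk | hpk
    · rw [h3, hpk]
      simp
    · rw [hpk]
      field_simp
      ring
  · intro l _ hl
    simp [Matrix.diagonal_apply_ne _ hl.symm]
  · simp

lemma pd_christoffel_semiFlatForm (l k i j : Fin 3 ⊕ Fin 3) :
    pd l (christoffel (metricMatrix (semiFlatForm moduliMetric)) k i j) 0 =
      christoffelCoeff k i j * (if l = Sum.inl 0 then 1 else 0) * (8 * Real.pi ^ 2) := by
  have hopen : IsOpen {y : Fin 3 ⊕ Fin 3 → ℝ | 0 < 1 + 4 * Real.pi * y (Sum.inl 0)} :=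
    isOpen_lt continuous_const (by fun_prop)
  have heq : christoffel (metricMatrix (semiFlatForm moduliMetric)) k i j =ᶠ[nhds 0]
      fun y => christoffelCoeff k i j * (-(2 * Real.pi) * (1 + 4 * Real.pi * y (Sum.inl 0))⁻¹) := by
    filter_upwards [hopen.mem_nhds (by simp : (0 : Fin 3 ⊕ Fin 3 → ℝ) ∈ _)] with y hy
    exact christoffel_semiFlatForm hy k i j
  have hy : 1 + 4 * Real.pi * (0 : Fin 3 ⊕ Fin 3 → ℝ) (Sum.inl 0) ≠ 0 := by simp
  have h1 := (hasDerivAt_inv hy).comp_hasFDerivAt (0 : Fin 3 ⊕ Fin 3 → ℝ)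
    (((ContinuousLinearMap.proj (R := ℝ) (φ := fun _ : Fin 3 ⊕ Fin 3 => ℝ)
      (Sum.inl 0)).hasFDerivAt.const_mul (4 * Real.pi)).const_add 1)
  have h2 : HasFDerivAt (fun y : Fin 3 ⊕ Fin 3 → ℝ => (christoffelCoeff k i j : ℝ) *
      (-(2 * Real.pi) * (1 + 4 * Real.pi * y (Sum.inl 0))⁻¹)) _ 0 :=
    (h1.const_mul (-(2 * Real.pi))).const_mul (christoffelCoeff k i j : ℝ)
  rw [pd, heq.fderiv_eq, h2.fderiv]
  by_cases hl : l = Sum.inl 0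
  · subst hl
    simp only [smul_apply, ContinuousLinearMap.proj_apply,
      Pi.single_eq_same, smul_eq_mul, if_true, Pi.zero_apply, mul_zero, add_zero]
    ring
  · simp [hl, Ne.symm hl]

/-- The Ricci curvature at the origin in the direction of the first coordinate. -/
lemma ricci_semiFlatForm : ricci (metricMatrix (semiFlatForm moduliMetric)) (Sum.inl 0)
    (Sum.inl 0) 0 = -(8 * Real.pi ^ 2) := by
  have hy : 0 < 1 + 4 * Real.pi * (0 : Fin 3 ⊕ Fin 3 → ℝ) (Sum.inl 0) := by simp
  -- At the origin every Christoffel symbol is an integer times -2π and its u₀-derivative is the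
  -- same integer times 8π². The Ricci component is thus 8π² times the first integer sum plus 4π²
  -- times the second, and both sums are finite computations.
  have h1 : ∑ k, (christoffelCoeff k (Sum.inl 0) (Sum.inl 0) * (if k = Sum.inl 0 then 1 else 0) -
      christoffelCoeff k (Sum.inl 0) k) = -1 := by decide
  have h2 : ∑ k, ∑ l, (christoffelCoeff k k l * christoffelCoeff l (Sum.inl 0) (Sum.inl 0) -
      christoffelCoeff k (Sum.inl 0) l * christoffelCoeff l (Sum.inl 0) k) = 0 := by decide
  have h3 := congrArg (Int.cast : ℤ → ℝ) h1
  have h4 := congrArg (Int.cast : ℤ → ℝ) h2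
  push_cast at h3 h4
  rw [ricci]
  simp only [pd_christoffel_semiFlatForm, christoffel_semiFlatForm hy]
  have h5 : ∀ k, ((christoffelCoeff k (Sum.inl 0) (Sum.inl 0) : ℝ) *
      (if k = Sum.inl 0 then 1 else 0) * (8 * Real.pi ^ 2) -
      christoffelCoeff k (Sum.inl 0) k * (if True then 1 else 0) *
        (8 * Real.pi ^ 2) +
      ∑ l, ((christoffelCoeff k k l : ℝ) *
        (-(2 * Real.pi) * (1 + 4 * Real.pi * (0 : Fin 3 ⊕ Fin 3 → ℝ) (Sum.inl 0))⁻¹) *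
        (christoffelCoeff l (Sum.inl 0) (Sum.inl 0) *
        (-(2 * Real.pi) * (1 + 4 * Real.pi * (0 : Fin 3 ⊕ Fin 3 → ℝ) (Sum.inl 0))⁻¹)) -
        (christoffelCoeff k (Sum.inl 0) l : ℝ) *
        (-(2 * Real.pi) * (1 + 4 * Real.pi * (0 : Fin 3 ⊕ Fin 3 → ℝ) (Sum.inl 0))⁻¹) *
        (christoffelCoeff l (Sum.inl 0) k *
        (-(2 * Real.pi) * (1 + 4 * Real.pi * (0 : Fin 3 ⊕ Fin 3 → ℝ) (Sum.inl 0))⁻¹)))) =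
      (8 * Real.pi ^ 2) * ((christoffelCoeff k (Sum.inl 0) (Sum.inl 0) : ℝ) *
      (if k = Sum.inl 0 then 1 else 0) - christoffelCoeff k (Sum.inl 0) k) +
      (4 * Real.pi ^ 2) * ∑ l, ((christoffelCoeff k k l : ℝ) *
        christoffelCoeff l (Sum.inl 0) (Sum.inl 0) -
        christoffelCoeff k (Sum.inl 0) l * christoffelCoeff l (Sum.inl 0) k) := by
    intro k
    rw [Finset.mul_sum]
    congr 1
    · simp only [if_true]
      ring
    · refine Finset.sum_congr rfl fun l _ => ?_
      simp
      ring
  rw [Finset.sum_congr rfl fun k _ => h5 k, Finset.sum_add_distrib, ← Finset.mul_sum,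
    ← Finset.mul_sum, h3, h4]
  ring

lemma not_isRicciFlat_semiFlatForm {r : ℝ} (hr : 0 < r) :
    ¬ IsRicciFlat (tube (moduliBase r)) (semiFlatForm moduliMetric) := by
  intro h
  have hmem : toC3 0 ∈ tube (moduliBase r) := by
    have h0 : toC3 0 = 0 := by
      ext j
      simp [toC3]
    rw [h0]
    exact zero_mem_moduliBase hr
  have h1 := h 0 hmem (Sum.inl 0) (Sum.inl 0)
  rw [ricci_semiFlatForm] at h1
  have := Real.pi_pos
  nlinarith [sq_pos_of_pos this]

/-! ### The one-parameter family -/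

lemma contDiff_affineOf_line : ContDiff ℝ (⊤ : ℕ∞) fun t : ℝ => affineOf ![t, 0, 0] := by
  rw [contDiff_pi]
  intro k
  fin_cases k
  · simp only [affineOf]
    simp
    fun_prop
  · simp [affineOf]
    fun_prop
  · simp [affineOf]
    fun_prop

lemma det_moduliMetric_affineOf (t : ℝ) :
    (moduliMetric (affineOf ![t, 0, 0])).det = Real.exp (4 * Real.pi * t) := by
  have h : 1 + 4 * Real.pi * affineOf ![t, 0, 0] 0 = Real.exp (-(4 * Real.pi * t)) := by
    simp [affineOf]
    field_simp
    ring
  rw [moduliMetric, Matrix.det_diagonal, Fin.prod_univ_three]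
  simp only [Matrix.cons_val, mul_one, h]
  rw [← Real.exp_neg, neg_neg]

end SLagTori

end

/-! ### Assembly of the example. -/

theorem mainTheorem5 :
    -- a Calabi-Yau structure on a neighbourhood of the standard torus in `ℂ³ / ℤ³`
    ∃ (U : Set C3) (Ω : C3 → C3 [⋀^Fin 3]→L[ℂ] ℂ) (ω : C3 → C3 [⋀^Fin 2]→L[ℝ] ℝ),
      IsCalabiYau U Ω ω ∧
    -- the one-parameter family of horizontal slices, with diagonal metrics of determinant one
    ∃ (δ : ℝ) (a : Fin 3 → ℝ → ℝ → ℝ), 0 < δ ∧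
      (∀ i, AnalyticOnNhd ℝ (fun p : ℝ × ℝ => a i p.1 p.2) (Set.univ ×ˢ Set.Ioo (-δ) δ)) ∧
      (∀ t ∈ Set.Ioo (-δ) δ, ∀ s, a 0 s t * a 1 s t * a 2 s t = 1) ∧
      (∀ t ∈ Set.Ioo (-δ) δ, IsSLagTorus U Ω ω (slice t) ∧
        ∀ x, inducedMetric ω (slice t) x = Matrix.diagonal (fun i => a i (x 0) t)) ∧
    -- it is a smooth curve `γ` in the local moduli space of deformations of the slice `t = 0`
    ∃ (B : Set R3) (𝓕 : R3 → R3 → C3) (γ : ℝ → R3),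
      IsLocalModuli U Ω ω (slice 0) B 𝓕 ∧
      ContDiffOn ℝ (⊤ : ℕ∞) γ (Set.Ioo (-δ) δ) ∧
      (∀ t ∈ Set.Ioo (-δ) δ, γ t ∈ B ∧ 𝓕 (γ t) = slice t) ∧
    -- the harmonic forms dual to the integral homology basis, and the matrix of `L²` products
    ∃ (θ : R3 → Fin 3 → R3 → R3) (h : R3 → Matrix (Fin 3) (Fin 3) ℝ),
      (∀ q ∈ B, IsDualHarmonicBasis (inducedMetric ω (𝓕 q)) (θ q)) ∧
      (∀ q ∈ B, h q = l2Gram (inducedMetric ω (𝓕 q)) (θ q)) ∧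
    -- `Φ = det ⟨θ_i, θ_j⟩` is not constant along the family
      (∃ t₁ ∈ Set.Ioo (-δ) δ, ∃ t₂ ∈ Set.Ioo (-δ) δ, (h (γ t₁)).det ≠ (h (γ t₂)).det) ∧
    -- the semi-flat structure on the mirror is Kähler, but neither Calabi-Yau nor Ricci-flat
      IsKahlerForm (tube B) (semiFlatForm h) ∧
      IsHolomorphicVolumeForm (tube B) (fun _ => stdVolumeForm) ∧
      ¬ CalabiYauRelation (tube B) (fun _ => stdVolumeForm) (semiFlatForm h) ∧
      ¬ IsRicciFlat (tube B) (semiFlatForm h) := by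
  have hr : (0 : ℝ) < 1 / 100 := by norm_num
  have hf := isNormalizedTriple_potential
  have hline : ∀ t ∈ Set.Ioo (-(1 / 100) : ℝ) (1 / 100), |(![t, 0, 0] : R3) 0| < 1 / 100 :=
    fun t ht => abs_lt.2 ht
  refine ⟨strip (1 / 100), fun _ => stdVolumeForm, ansatzForm potential,
    hf.toIsPotentialTriple.isCalabiYau hr,
    1 / 100, fun i s t => weight potential (s + Complex.I * t) i, hr, ?_, ?_, ?_,
    moduliBase (1 / 100), fun u => torus potential (actionOf u), fun t => affineOf ![t, 0, 0],
    ?_, contDiff_affineOf_line.contDiffOn, fun t ht => ⟨affineOf_mem (hline t ht), ?_⟩,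
    harmonicBasis potential, moduliMetric, ?_, ?_, ?_, isKahlerForm_semiFlatForm _,
    IsPotentialTriple.isHolomorphicVolumeForm (isOpen_tube_moduliBase _),
    not_calabiYauRelation_semiFlatForm hr, not_isRicciFlat_semiFlatForm hr⟩
  · exact fun k p hp => analyticAt_weight_potential k (abs_lt.2 hp.2)
  · intro t ht s
    exact hf.weight_prod (by simpa using hline t ht)
  · intro t ht
    rw [← hf.torus_slice]
    exact ⟨hf.isSLagTorus_torus (hline t ht), fun x => hf.inducedMetric_torus (hline t ht) x⟩
  · exact hf.isLocalModuli hr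
  · simp only [actionOf_affineOf, hf.torus_slice]
  · exact fun u hu => hf.isDualHarmonicBasis hu
  · exact fun u hu => (hf.l2Gram_harmonicBasis hu).symm
  -- Along the slices Φ = e^{4πt}, which is injective in t, so any two parameters serve.
  · refine ⟨0, by norm_num, 1 / 200, by norm_num, fun h => ?_⟩
    rw [det_moduliMetric_affineOf, det_moduliMetric_affineOf, Real.exp_eq_exp] at h
    have := Real.pi_pos
    linarith
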